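/- Let $k,l$ be positive integers with $l\ge 3$ and $4\mid k$, put $n_1=2^{l-1}+1$, $n_2=2^{l-1}-1$, and let $$G=\mathbb Z_{2^l}\rtimes D_k=\langle a,u,v \mid a^{2^l}=u^k=v^2=1,\ uau^{-1}=a^{n_1},\ vav=a^{n_2},\ vuv=u^{-1}\rangle .$$ Let $D(G)$ be the Drinfel'd double of $G$ over $\mathbb C$, i.e. the Hopf algebra with basis $p_g\bowtie x$ $(g,x\in G)$, product $(p_g\bowtie x)(p_h\bowtie y)=\delta_{g,xhx^{-1}}\,p_g\bowtie xy$, coproduct $\Delta(p_g\bowtie x)=\sum_{st=g}(p_t\bowtie x)\otimes(p_s\bowtie x)$ and counit $\varepsilon(p_g\bowtie x)=\delta_{g,1}$. Let $\Lambda$ be its unique integral with $\varepsilon(\Lambda)=1$. For a finite-dimensional $D(G)$-module $V$ with character $\chi$ and $m\ge 1$, the $m$-th indicator is $\nu_m(V)=\chi(\Lambda^{[m]})$, where $\Lambda^{[m]}=\sum\Lambda_1\Lambda_2\cdots\Lambda_m$. For $s\in G$ and a representation $\rho$ of the centralizer $C_G(s)$ on $W$, choose for each $t$ in the conjugacy class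 $\mathrm{class}(s)$ an element $g_t\in G$ with $g_tsg_t^{-1}=t$. Then $M(\mathrm{class}(s),\rho)=\bigoplus_{t\in\mathrm{class}(s)}g_t\otimes W$ is the $D(G)$-module on which $p_h$ acts as the projection onto the summand $t=h$ and $x\in G$ acts by $x\cdot(g_t\otimes w)=g_{t'}\otimes\rho(\gamma)w$, where $t'=xtx^{-1}$ and $xg_t=g_{t'}\gamma$ with $\gamma\in C_G(s)$. **Theorem.** Let $r,i\in\mathbb Z$, let $\eta$ be any linear character of $C_G(a^ru^{2i-1})$, and let $H=\langle a^2,u^2\rangle$. Then $H\subseteq C_G(a^ru^{2i-1})$, the $D(G)$-module $V=M(\mathrm{class}(a^ru^{2i-1}),\eta)$ is irreducible of dimension $4$, and for every integer $m>1$ $$\nu_m(V)=\begin{cases} 4, & k\mid m(2i-1)\ \wedge\ 2^l\mid mr\ \wedge\ \eta^{m/2}|_H=1,\\ 2, & 4\mid m\ \wedge\ \bigl(k\nmid m(2i-1)\ \vee\ 2^l\nmid mr\ \vee\ \eta^{m/2}|_H\ne 1\bigr),\\ 1, & 2\mid m\ \wedge\ 4\nmid m,\\ 0, & 2\nmid m.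 \end{cases}$$ (In the first case $k\mid m(2i-1)$ and $4\mid k$ force $4\mid m$, so that $m/2$ is an integer.) In particular, $\nu_2(V)=1$. -/

import Mathlib

open scoped TensorProduct

noncomputable section

/-! ### Indicators of modules over a Hopf algebra -/

section Indicators

variable (H : Type*) [Ring H] [HopfAlgebra ℂ H]

/-- `Λ` is a (left) integral of `H`, normalised by `ε(Λ) = 1`. -/
structure IsNormalizedIntegral {H : Type*} [Ring H] [HopfAlgebra ℂ H] (Λ : H) : Prop where
  mul_eq : ∀ h : H, h * Λ = Coalgebra.counit (R := ℂ) h • Λ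
  counit_eq : Coalgebra.counit (R := ℂ) Λ = 1

/-- The integral `Λ` of `H` with `ε(Λ) = 1` (a junk value if there is none). For the double of a finite
group there is exactly one, see `DrinfeldDouble.isNormalizedIntegral_iff`. -/
def normalizedIntegral : H := Classical.epsilon fun Λ : H => IsNormalizedIntegral Λ

/-- The `m`-th Sweedler power map `h ↦ h^{[m]} = ∑ h₁ h₂ ⋯ hₘ` (and `h^{[0]} = ε(h) 1`). -/
def sweedlerPow : ℕ → H →ₗ[ℂ] H
  | 0 => Algebra.linearMap ℂ H ∘ₗ Coalgebra.counit
  | m + 1 => LinearMap.mul' ℂ H ∘ₗ TensorProduct.map (sweedlerPow m) LinearMap.id ∘ₗ Coalgebra.comul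

/-- The character of an `H`-module `V`. -/
def moduleCharacter (V : Type*) [AddCommGroup V] [Module ℂ V] [Module H V] [IsScalarTower ℂ H V]
    (h : H) : ℂ :=
  LinearMap.trace ℂ V (Algebra.lsmul ℂ ℂ V h)

/-- The `m`-th indicator `ν_m(V) = χ_V(Λ^{[m]})`. -/
def indicator (V : Type*) [AddCommGroup V] [Module ℂ V] [Module H V] [IsScalarTower ℂ H V]
    (m : ℕ) : ℂ :=
  moduleCharacter H V (sweedlerPow H m (normalizedIntegral H))

end Indicators

/-! ### The Drinfel'd double of a finite group -/

/-- The vector space `ℂ^G ⊗ ℂG`, with basis `p_g ⋈ x` indexed by the pairs `(g, x)`. -/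
def DrinfeldDouble (G : Type*) : Type _ := G × G →₀ ℂ

namespace DrinfeldDouble

variable {G : Type*}

instance : AddCommGroup (DrinfeldDouble G) := inferInstanceAs (AddCommGroup (G × G →₀ ℂ))
instance : Module ℂ (DrinfeldDouble G) := inferInstanceAs (Module ℂ (G × G →₀ ℂ))

/-- The basis element `p_g ⋈ x`. -/
def bas (g x : G) : DrinfeldDouble G := Finsupp.single (g, x) (1 : ℂ)

/-- The linear map with prescribed values on the basis `p_g ⋈ x`. -/
def lift {M : Type*} [AddCommGroup M] [Module ℂ M] (f : G → G → M) : DrinfeldDouble G →ₗ[ℂ] M :=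
  Finsupp.linearCombination ℂ (fun q : G × G => f q.1 q.2)

@[simp] theorem lift_bas {M : Type*} [AddCommGroup M] [Module ℂ M] (f : G → G → M) (g x : G) :
    lift f (bas g x) = f g x :=
  (Finsupp.linearCombination_single ℂ (1 : ℂ) (g, x)).trans (one_smul ℂ _)

theorem hom_ext {M : Type*} [AddCommGroup M] [Module ℂ M] {f f' : DrinfeldDouble G →ₗ[ℂ] M}
    (h : ∀ g x, f (bas g x) = f' (bas g x)) : f = f' :=
  Finsupp.lhom_ext' fun q => LinearMap.ext_ring (h q.1 q.2)

variable [Group G]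

open Classical in
/-- The multiplication `(p_g ⋈ x)(p_h ⋈ y) = δ_{g, x h x⁻¹} p_g ⋈ xy`. -/
def mulMap : DrinfeldDouble G →ₗ[ℂ] DrinfeldDouble G →ₗ[ℂ] DrinfeldDouble G :=
  lift fun g x => lift fun h y => if g = x * h * x⁻¹ then bas g (x * y) else 0

instance : Mul (DrinfeldDouble G) := ⟨fun d e => mulMap d e⟩

theorem mul_def (d e : DrinfeldDouble G) : d * e = mulMap d e := rfl

open Classical in
theorem bas_mul_bas (g x h y : G) :
    bas g x * bas h y = if g = x * h * x⁻¹ then bas g (x * y) else 0 := by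
  simp [mul_def, mulMap]

theorem mul_assoc_aux (a b c : DrinfeldDouble G) : a * b * c = a * (b * c) := by
  have h : (mulMap (G := G)).compr₂ mulMap =
      ((LinearMap.llcomp ℂ (DrinfeldDouble G) (DrinfeldDouble G) (DrinfeldDouble G)).flip.comp
        (mulMap (G := G))).flip.comp (mulMap (G := G)) := by
    refine hom_ext fun g x => hom_ext fun h y => hom_ext fun i z => ?_
    change bas g x * bas h y * bas i z = bas g x * (bas h y * bas i z)
    have e0 : ∀ d : DrinfeldDouble G, 0 * d = 0 := fun d => by simp [mul_def]
    have e1 : ∀ d : DrinfeldDouble G, d * 0 = 0 := fun d => by simp [mul_def]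
    simp only [bas_mul_bas]
    split_ifs with h1 h2 h2 <;> simp only [bas_mul_bas, e0, e1]
    · rw [if_pos, if_pos h1, mul_assoc]
      rw [h1, h2]; group
    · rw [if_neg]
      intro h3
      apply h2
      rw [h1] at h3
      have := congrArg (fun t => x⁻¹ * t * x) h3
      simpa [mul_assoc] using this
    · rw [if_neg h1]
  exact LinearMap.congr_fun (LinearMap.congr_fun (LinearMap.congr_fun h a) b) c

variable [Fintype G]

instance : One (DrinfeldDouble G) := ⟨∑ g : G, bas g 1⟩

theorem one_def : (1 : DrinfeldDouble G) = ∑ g : G, bas g 1 := rfl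

theorem one_mul_aux (a : DrinfeldDouble G) : 1 * a = a := by
  classical
  have h : mulMap (1 : DrinfeldDouble G) = LinearMap.id := by
    refine hom_ext fun g x => ?_
    rw [one_def, map_sum, LinearMap.sum_apply]
    change ∑ h : G, bas h 1 * bas g x = bas g x
    simp [bas_mul_bas]
  exact LinearMap.congr_fun h a

theorem mul_one_aux (a : DrinfeldDouble G) : a * 1 = a := by
  classical
  have h : (mulMap (G := G)).flip (1 : DrinfeldDouble G) = LinearMap.id := by
    refine hom_ext fun g x => ?_
    change bas g x * 1 = bas g x
    rw [one_def]
    change mulMap (bas g x) (∑ h : G, bas h 1) = _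
    rw [map_sum]
    change ∑ h : G, bas g x * bas h 1 = bas g x
    have : ∀ h : G, g = x * h * x⁻¹ ↔ h = x⁻¹ * g * x := fun h => by
      constructor
      · rintro rfl; group
      · rintro rfl; group
    simp [bas_mul_bas, this]
  exact LinearMap.congr_fun h a

instance : Ring (DrinfeldDouble G) :=
  { (inferInstance : AddCommGroup (DrinfeldDouble G)) with
    mul := (· * ·)
    one := 1
    left_distrib := fun a b c => by simp [mul_def]
    right_distrib := fun a b c => by simp [mul_def]
    zero_mul := fun a => by simp [mul_def]
    mul_zero := fun a => by simp [mul_def]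
    mul_assoc := mul_assoc_aux
    one_mul := one_mul_aux
    mul_one := mul_one_aux }

instance : Algebra ℂ (DrinfeldDouble G) :=
  Algebra.ofModule (fun r a b => by simp [mul_def]) (fun r a b => by simp [mul_def])

open Classical in
/-- The counit `ε(p_g ⋈ x) = δ_{g,1}`, and the comultiplication of `(ℂ^G)^{cop} ⊗ ℂG`,
`Δ(p_g ⋈ x) = ∑_{st = g} (p_t ⋈ x) ⊗ (p_s ⋈ x)` (so that `t = s⁻¹ g`). -/
instance : CoalgebraStruct ℂ (DrinfeldDouble G) where
  counit := lift fun g _ => if g = 1 then 1 else 0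
  comul := lift fun g x => ∑ s : G, bas (s⁻¹ * g) x ⊗ₜ[ℂ] bas s x

open Classical in
theorem counit_bas (g x : G) :
    Coalgebra.counit (R := ℂ) (bas g x) = if g = 1 then 1 else 0 :=
  lift_bas _ g x

theorem comul_bas (g x : G) :
    Coalgebra.comul (R := ℂ) (bas g x) = ∑ s : G, bas (s⁻¹ * g) x ⊗ₜ[ℂ] bas s x :=
  lift_bas _ g x

instance : Coalgebra ℂ (DrinfeldDouble G) where
  coassoc := by
    refine hom_ext fun g x => ?_
    simp only [LinearMap.comp_apply, comul_bas, map_sum, LinearMap.rTensor_tmul,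
      LinearMap.lTensor_tmul, TensorProduct.sum_tmul, TensorProduct.tmul_sum,
      LinearEquiv.coe_coe, TensorProduct.assoc_tmul]
    refine Eq.trans ?_ Finset.sum_comm
    refine Finset.sum_congr rfl fun s _ => ?_
    symm
    rw [← Equiv.sum_comp (Equiv.mulLeft s)]
    simp [mul_assoc]
  rTensor_counit_comp_comul := by
    classical
    refine hom_ext fun g x => ?_
    simp only [LinearMap.comp_apply, comul_bas, map_sum, LinearMap.rTensor_tmul, counit_bas]
    rw [Finset.sum_eq_single g]
    · simp
    · intro s _ hs
      rw [if_neg, TensorProduct.zero_tmul]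
      intro h; exact hs (inv_mul_eq_one.mp h)
    · simp
  lTensor_counit_comp_comul := by
    classical
    refine hom_ext fun g x => ?_
    simp only [LinearMap.comp_apply, comul_bas, map_sum, LinearMap.lTensor_tmul, counit_bas]
    rw [Finset.sum_eq_single 1]
    · simp
    · intro s _ hs
      rw [if_neg hs, TensorProduct.tmul_zero]
    · simp

instance : Bialgebra ℂ (DrinfeldDouble G) where
  counit_one := by
    classical
    rw [one_def, map_sum]
    simp [counit_bas]
  mul_compr₂_counit := by
    classical
    refine hom_ext fun g x => hom_ext fun h y => ?_
    simp only [LinearMap.compr₂_apply, LinearMap.mul_apply', LinearMap.compl₁₂_apply, bas_mul_bas,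
      counit_bas]
    by_cases hh : h = 1
    · subst hh
      by_cases hg : g = 1 <;> simp [hg, counit_bas]
    · by_cases hg : g = 1
      · rw [if_neg]
        · simp [hh]
        · intro h1
          rw [hg] at h1
          exact hh (conj_eq_one_iff.mp h1.symm)
      · split_ifs <;> simp [hg, counit_bas]
  comul_one := by
    rw [one_def, map_sum, Algebra.TensorProduct.one_def, one_def]
    simp only [comul_bas, TensorProduct.sum_tmul, TensorProduct.tmul_sum]
    rw [Finset.sum_comm]
    refine Finset.sum_congr rfl fun s _ => ?_
    rw [← Equiv.sum_comp (Equiv.mulLeft s)]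
    simp
  mul_compr₂_comul := by
    classical
    refine hom_ext fun g x => hom_ext fun h y => ?_
    simp only [LinearMap.compr₂_apply, LinearMap.mul_apply', LinearMap.compl₁₂_apply, bas_mul_bas,
      comul_bas, Finset.sum_mul_sum, Algebra.TensorProduct.tmul_mul_tmul]
    have key : ∀ s : G, (∑ t : G,
        (if s⁻¹ * g = x * (t⁻¹ * h) * x⁻¹ then bas (s⁻¹ * g) (x * y) else 0) ⊗ₜ[ℂ]
          (if s = x * t * x⁻¹ then bas s (x * y) else 0)) =
        if g = x * h * x⁻¹ then bas (s⁻¹ * g) (x * y) ⊗ₜ[ℂ] bas s (x * y) else 0 := by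
      intro s
      rw [Finset.sum_eq_single (x⁻¹ * s * x)]
      · rw [if_pos (by group : s = x * (x⁻¹ * s * x) * x⁻¹)]
        have : s⁻¹ * g = x * ((x⁻¹ * s * x)⁻¹ * h) * x⁻¹ ↔ g = x * h * x⁻¹ := by
          have e : x * ((x⁻¹ * s * x)⁻¹ * h) * x⁻¹ = s⁻¹ * (x * h * x⁻¹) := by group
          rw [e, mul_right_inj]
        simp only [this]
        split_ifs <;> simp
      · intro t _ ht
        rw [if_neg (c := s = x * t * x⁻¹), TensorProduct.tmul_zero]
        intro h1
        apply ht
        rw [h1]; group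
      · simp
    simp only [key]
    split_ifs <;> simp [comul_bas]

/-- The antipode is `S(p_g ⋈ x) = p_{x⁻¹ g⁻¹ x} ⋈ x⁻¹`. -/
instance : HopfAlgebra ℂ (DrinfeldDouble G) where
  antipode := lift fun g x => bas (x⁻¹ * g⁻¹ * x) x⁻¹
  mul_antipode_rTensor_comul := by
    classical
    refine hom_ext fun g x => ?_
    simp only [LinearMap.comp_apply, comul_bas, map_sum, LinearMap.rTensor_tmul, lift_bas,
      LinearMap.mul'_apply, bas_mul_bas, counit_bas, Algebra.linearMap_apply]
    by_cases hg : g = 1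
    · subst hg
      simp only [mul_one, inv_inv, if_true, map_one, inv_mul_cancel, one_def]
      exact Fintype.sum_equiv (MulAut.conj x⁻¹).toEquiv _ _ fun s => by simp
    · rw [if_neg hg, map_zero]
      refine Finset.sum_eq_zero fun s _ => if_neg fun h => hg ?_
      simpa [mul_assoc] using h
  mul_antipode_lTensor_comul := by
    classical
    refine hom_ext fun g x => ?_
    simp only [LinearMap.comp_apply, comul_bas, map_sum, LinearMap.lTensor_tmul, lift_bas,
      LinearMap.mul'_apply, bas_mul_bas, counit_bas, Algebra.linearMap_apply]
    by_cases hg : g = 1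
    · subst hg
      simp only [mul_one, if_true, map_one, mul_inv_cancel, one_def]
      refine Fintype.sum_equiv (Equiv.inv G) _ _ fun s => ?_
      rw [if_pos (by group)]
      rfl
    · rw [if_neg hg, map_zero]
      refine Finset.sum_eq_zero fun s _ => if_neg fun h => hg ?_
      have e : x * (x⁻¹ * s⁻¹ * x) * x⁻¹ = s⁻¹ * 1 := by group
      rw [e] at h
      exact mul_left_cancel h

/-- The double of a finite group has exactly one normalised integral, namely
`|G|⁻¹ ∑_y p_1 ⋈ y`. -/
theorem isNormalizedIntegral_iff (Λ : DrinfeldDouble G) :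
    IsNormalizedIntegral Λ ↔ Λ = (Fintype.card G : ℂ)⁻¹ • ∑ y : G, bas 1 y := by
  classical
  have hc : (Fintype.card G : ℂ) ≠ 0 := by exact_mod_cast Fintype.card_ne_zero
  have hl : ∀ h : DrinfeldDouble G, h * ((Fintype.card G : ℂ)⁻¹ • ∑ y : G, bas 1 y) =
      Coalgebra.counit (R := ℂ) h • ((Fintype.card G : ℂ)⁻¹ • ∑ y : G, bas 1 y) := by
    intro d
    have : (LinearMap.mul ℂ (DrinfeldDouble G)).flip
        ((Fintype.card G : ℂ)⁻¹ • ∑ y : G, bas 1 y) =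
        (Coalgebra.counit (R := ℂ) (A := DrinfeldDouble G)).smulRight
          ((Fintype.card G : ℂ)⁻¹ • ∑ y : G, bas 1 y) := by
      refine hom_ext fun g x => ?_
      simp only [LinearMap.flip_apply, LinearMap.mul_apply', LinearMap.smulRight_apply, counit_bas,
        mul_smul_comm, Finset.mul_sum, bas_mul_bas, mul_one, mul_inv_cancel]
      by_cases hg : g = 1
      · subst hg
        simp only [if_true, one_smul]
        congr 1
        exact Equiv.sum_comp (Equiv.mulLeft x) (fun y => bas 1 y)
      · simp [hg]
    exact LinearMap.congr_fun this d
  have hr : ∀ h : DrinfeldDouble G, ((Fintype.card G : ℂ)⁻¹ • ∑ y : G, bas 1 y) * h =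
      Coalgebra.counit (R := ℂ) h • ((Fintype.card G : ℂ)⁻¹ • ∑ y : G, bas 1 y) := by
    intro d
    have : (LinearMap.mul ℂ (DrinfeldDouble G))
        ((Fintype.card G : ℂ)⁻¹ • ∑ y : G, bas 1 y) =
        (Coalgebra.counit (R := ℂ) (A := DrinfeldDouble G)).smulRight
          ((Fintype.card G : ℂ)⁻¹ • ∑ y : G, bas 1 y) := by
      refine hom_ext fun g x => ?_
      simp only [LinearMap.mul_apply', LinearMap.smulRight_apply, counit_bas,
        smul_mul_assoc, Finset.sum_mul, bas_mul_bas, eq_comm (a := (1 : G)), conj_eq_one_iff]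
      by_cases hg : g = 1
      · subst hg
        simp only [if_true, one_smul]
        congr 1
        exact Equiv.sum_comp (Equiv.mulRight x) (fun y => bas 1 y)
      · simp [hg]
    exact LinearMap.congr_fun this d
  have h1 : Coalgebra.counit (R := ℂ)
      ((Fintype.card G : ℂ)⁻¹ • ∑ y : G, bas 1 y : DrinfeldDouble G) = 1 := by
    simp [counit_bas, hc]
  constructor
  · intro h
    have e := h.mul_eq ((Fintype.card G : ℂ)⁻¹ • ∑ y : G, bas 1 y)
    rw [hr, h.counit_eq, h1, one_smul, one_smul] at e
    exact e.symm
  · rintro rfl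
    exact ⟨hl, h1⟩

theorem normalizedIntegral_eq :
    normalizedIntegral (DrinfeldDouble G) = (Fintype.card G : ℂ)⁻¹ • ∑ y : G, bas 1 y :=
  (isNormalizedIntegral_iff _).mp
    (Classical.epsilon_spec (p := fun Λ : DrinfeldDouble G => IsNormalizedIntegral Λ)
      ⟨_, (isNormalizedIntegral_iff _).mpr rfl⟩)

end DrinfeldDouble

/-! ### The modules `M(class(s), ρ)` -/

section DoubleModule

variable {G : Type*} [Group G] (s : G) {V : Type*} [AddCommGroup V] [Module ℂ V]

/-- For each `t` in the conjugacy class of `s`, a chosen `g_t ∈ G` with `g_t s g_t⁻¹ = t`. -/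
def conjRep (t : conjugatesOf s) : G := (isConj_iff.mp t.2).choose

theorem conjRep_spec (t : conjugatesOf s) : conjRep s t * s * (conjRep s t)⁻¹ = t :=
  (isConj_iff.mp t.2).choose_spec

variable {s}

/-- The element `x t x⁻¹` of the conjugacy class of `s`. -/
def conjClassAct (x : G) (t : conjugatesOf s) : conjugatesOf s :=
  ⟨x * t * x⁻¹, IsConj.trans t.2 (isConj_iff.mpr ⟨x, rfl⟩)⟩

/-- The element `γ = g_{t'}⁻¹ x g_t ∈ C_G(s)`, where `t' = x t x⁻¹`; so `x g_t = g_{t'} γ`. -/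
def cocycle (x : G) (t : conjugatesOf s) : Subgroup.centralizer ({s} : Set G) :=
  ⟨(conjRep s (conjClassAct x t))⁻¹ * x * conjRep s t, by
    rw [Subgroup.mem_centralizer_singleton_iff]
    have h1 : conjRep s t * s = t * conjRep s t := mul_inv_eq_iff_eq_mul.mp (conjRep_spec s t)
    have h2 : conjRep s (conjClassAct x t) * s = x * t * x⁻¹ * conjRep s (conjClassAct x t) :=
      mul_inv_eq_iff_eq_mul.mp (conjRep_spec s (conjClassAct x t))
    have h3 : s * (conjRep s (conjClassAct x t))⁻¹ =
        (conjRep s (conjClassAct x t))⁻¹ * (x * t * x⁻¹) := by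
      rw [mul_inv_eq_iff_eq_mul, mul_assoc, eq_inv_mul_iff_mul_eq]
      exact h2
    calc (conjRep s (conjClassAct x t))⁻¹ * x * conjRep s t * s
        = (conjRep s (conjClassAct x t))⁻¹ * x * (conjRep s t * s) := by simp only [mul_assoc]
      _ = (conjRep s (conjClassAct x t))⁻¹ * (x * t * x⁻¹) * x * conjRep s t := by
          rw [h1]; simp [mul_assoc]
      _ = s * ((conjRep s (conjClassAct x t))⁻¹ * x * conjRep s t) := by
          rw [← h3]; simp only [mul_assoc]⟩

theorem conjClassAct_one (t : conjugatesOf s) : conjClassAct 1 t = t :=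
  Subtype.ext (by simp [conjClassAct])

theorem conjClassAct_mul (x y : G) (t : conjugatesOf s) :
    conjClassAct (x * y) t = conjClassAct x (conjClassAct y t) :=
  Subtype.ext (by simp [conjClassAct, mul_assoc])

theorem cocycle_one (t : conjugatesOf s) : cocycle 1 t = 1 :=
  Subtype.ext (by simp [cocycle, conjClassAct_one])

theorem cocycle_mul (x y : G) (t : conjugatesOf s) :
    cocycle (x * y) t = cocycle x (conjClassAct y t) * cocycle y t :=
  Subtype.ext (by simp [cocycle, conjClassAct_mul, mul_assoc])

theorem conjClassAct_inv (x : G) (t : conjugatesOf s) :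
    conjClassAct x (conjClassAct x⁻¹ t) = t := by
  rw [← conjClassAct_mul, mul_inv_cancel, conjClassAct_one]

variable (s) in
/-- The vector space `M(class(s), ρ) = ⨁_t g_t ⊗ V`, the sum being over the conjugacy class of `s`;
the component of `f` at `t` is `f t`. -/
def ClassModule (_ρ : Representation ℂ (Subgroup.centralizer ({s} : Set G)) V) : Type _ :=
  conjugatesOf s → V

namespace ClassModule

variable (ρ : Representation ℂ (Subgroup.centralizer ({s} : Set G)) V)

instance : AddCommGroup (ClassModule s ρ) := inferInstanceAs (AddCommGroup (conjugatesOf s → V))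
instance : Module ℂ (ClassModule s ρ) := inferInstanceAs (Module ℂ (conjugatesOf s → V))

/-- The action of `x ∈ G`: it sends `g_t v` to `g_{t'} (γ v)`, where `x g_t = g_{t'} γ`. -/
def groupAct : Representation ℂ G (ClassModule s ρ) where
  toFun x :=
    { toFun := fun f t => ρ (cocycle x (conjClassAct x⁻¹ t)) (f (conjClassAct x⁻¹ t))
      map_add' := fun f f' => funext fun t => map_add (ρ _) _ _
      map_smul' := fun c f => funext fun t => map_smul (ρ _) _ _ }
  map_one' := LinearMap.ext fun f => funext fun t => by
    change ρ (cocycle 1 (conjClassAct 1⁻¹ t)) (f (conjClassAct 1⁻¹ t)) = f t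
    simp [conjClassAct_one, cocycle_one]
  map_mul' x y := LinearMap.ext fun f => funext fun t => by
    change ρ (cocycle (x * y) (conjClassAct (x * y)⁻¹ t)) (f (conjClassAct (x * y)⁻¹ t)) =
      ρ (cocycle x (conjClassAct x⁻¹ t)) (ρ (cocycle y (conjClassAct y⁻¹ (conjClassAct x⁻¹ t)))
        (f (conjClassAct y⁻¹ (conjClassAct x⁻¹ t))))
    simp [conjClassAct_mul, cocycle_mul, conjClassAct_inv]

open Classical in
/-- The action of `p_g`: the projection onto the component `g`. -/
def gradeProj (g : G) : Module.End ℂ (ClassModule s ρ) where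
  toFun f t := if (t : G) = g then f t else 0
  map_add' f f' := funext fun t => by
    change (if (t : G) = g then f t + f' t else 0) =
      (if (t : G) = g then f t else 0) + (if (t : G) = g then f' t else 0)
    split_ifs <;> simp
  map_smul' c f := funext fun t => by
    change (if (t : G) = g then c • f t else 0) = c • (if (t : G) = g then f t else 0)
    split_ifs <;> simp

open Classical in
theorem basAct_mul (g x h y : G) :
    (gradeProj ρ g * groupAct ρ x) * (gradeProj ρ h * groupAct ρ y) =
      if g = x * h * x⁻¹ then gradeProj ρ g * groupAct ρ (x * y) else 0 := by
  refine LinearMap.ext fun f => funext fun t => ?_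
  have key : (conjClassAct x⁻¹ t : G) = h ↔ (t : G) = x * h * x⁻¹ := by
    change x⁻¹ * t * x⁻¹⁻¹ = h ↔ _
    rw [inv_inv, mul_assoc, inv_mul_eq_iff_eq_mul, eq_mul_inv_iff_mul_eq]
  rw [map_mul, ← mul_assoc (gradeProj ρ g)]
  change (if (t : G) = g then ρ (cocycle x (conjClassAct x⁻¹ t))
    (if (conjClassAct x⁻¹ t : G) = h then groupAct ρ y f (conjClassAct x⁻¹ t) else 0) else 0) = _
  by_cases hg : g = x * h * x⁻¹
  · rw [if_pos hg]
    change _ = (if (t : G) = g then ρ (cocycle x (conjClassAct x⁻¹ t))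
      (groupAct ρ y f (conjClassAct x⁻¹ t)) else 0)
    by_cases ht : (t : G) = g
    · rw [if_pos ht, if_pos ht, if_pos (key.mpr (ht.trans hg))]
    · rw [if_neg ht, if_neg ht]
  · rw [if_neg hg]
    change _ = (0 : V)
    by_cases ht : (t : G) = g
    · rw [if_pos ht, if_neg (fun h' => hg (ht.symm.trans (key.mp h'))), map_zero]
    · rw [if_neg ht]

variable [Fintype G]

/-- The action of the double: `p_g ⋈ x` acts as the action of `x` followed by that of `p_g`. -/
def toEnd : DrinfeldDouble G →ₐ[ℂ] Module.End ℂ (ClassModule s ρ) :=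
  AlgHom.ofLinearMap (DrinfeldDouble.lift fun g x => gradeProj ρ g * groupAct ρ x)
    (by
      classical
      rw [DrinfeldDouble.one_def, map_sum]
      refine LinearMap.ext fun f => funext fun t => ?_
      simp only [DrinfeldDouble.lift_bas, map_one, mul_one, LinearMap.sum_apply]
      refine (Finset.sum_apply (M := fun _ : conjugatesOf s => V) t Finset.univ
        (fun g => (gradeProj ρ g f : conjugatesOf s → V))).trans ?_
      change ∑ g : G, (if (t : G) = g then f t else 0) = f t
      simp)
    (by
      classical
      have h : (LinearMap.mul ℂ (DrinfeldDouble G)).compr₂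
          (DrinfeldDouble.lift fun g x => gradeProj ρ g * groupAct ρ x) =
          (LinearMap.mul ℂ (Module.End ℂ (ClassModule s ρ))).compl₁₂
            (DrinfeldDouble.lift fun g x => gradeProj ρ g * groupAct ρ x)
            (DrinfeldDouble.lift fun g x => gradeProj ρ g * groupAct ρ x) := by
        refine DrinfeldDouble.hom_ext fun g x => DrinfeldDouble.hom_ext fun h y => ?_
        simp only [LinearMap.compr₂_apply, LinearMap.mul_apply', LinearMap.compl₁₂_apply,
          DrinfeldDouble.bas_mul_bas, DrinfeldDouble.lift_bas, basAct_mul]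
        split_ifs <;> simp
      exact fun a b => LinearMap.congr_fun (LinearMap.congr_fun h a) b)

instance : Module (DrinfeldDouble G) (ClassModule s ρ) :=
  Module.compHom (ClassModule s ρ) (toEnd ρ).toRingHom

theorem smul_def (d : DrinfeldDouble G) (f : ClassModule s ρ) : d • f = toEnd ρ d f := rfl

instance : IsScalarTower ℂ (DrinfeldDouble G) (ClassModule s ρ) where
  smul_assoc c d f := by simp [smul_def]

end ClassModule

/-- The one-dimensional representation of a group `C` on `ℂ` afforded by a linear character. -/
def linearRep {C : Type*} [Group C] (η : C →* ℂˣ) : Representation ℂ C ℂ where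
  toFun c := (η c : ℂ) • LinearMap.id
  map_one' := by ext; simp
  map_mul' c d := by ext; simp [mul_comm]

end DoubleModule

/-! ### The groups `ℤ_{2^l} ⋊ D_k` -/

/-- The names of the three generators. -/
inductive Gen
  | a
  | u
  | v

open FreeGroup in
/-- The relators of the presentation
`⟨a, u, v | a^{2^l} = u^k = v² = 1, u a u⁻¹ = a^{n₁}, v a v = a^{n₂}, v u v = u⁻¹⟩`,
where `n₁ = 2^{l-1} + 1` and `n₂ = 2^{l-1} - 1`. -/
def zdRels (k l : ℕ) : Set (FreeGroup Gen) :=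
  {of .a ^ 2 ^ l, of .u ^ k, of .v ^ 2,
    of .u * of .a * (of .u)⁻¹ * (of .a ^ (2 ^ (l - 1) + 1))⁻¹,
    of .v * of .a * of .v * (of .a ^ (2 ^ (l - 1) - 1))⁻¹,
    of .v * of .u * of .v * of .u}

/-- The group `ℤ_{2^l} ⋊ D_k`. -/
abbrev ZD (k l : ℕ) : Type := PresentedGroup (zdRels k l)

namespace ZD

variable (k l : ℕ)

/-- The generator `a`. -/
def a : ZD k l := PresentedGroup.of .a

/-- The generator `u`. -/
def u : ZD k l := PresentedGroup.of .u

/-- The generator `v`. -/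
def v : ZD k l := PresentedGroup.of .v

theorem rel {w : FreeGroup Gen} (hw : w ∈ zdRels k l) :
    PresentedGroup.mk (zdRels k l) w = 1 :=
  PresentedGroup.one_of_mem hw

theorem a_pow : a k l ^ 2 ^ l = 1 := by
  have h := rel k l (w := FreeGroup.of .a ^ 2 ^ l) (by simp [zdRels])
  rw [map_pow] at h
  exact h

theorem u_pow : u k l ^ k = 1 := by
  have h := rel k l (w := FreeGroup.of .u ^ k) (by simp [zdRels])
  rw [map_pow] at h
  exact h

theorem v_sq : v k l ^ 2 = 1 := by
  have h := rel k l (w := FreeGroup.of .v ^ 2) (by simp [zdRels])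
  rw [map_pow] at h
  exact h

theorem u_mul_a : u k l * a k l = a k l ^ (2 ^ (l - 1) + 1) * u k l := by
  have h := rel k l (w := FreeGroup.of .u * FreeGroup.of .a * (FreeGroup.of .u)⁻¹ *
    (FreeGroup.of .a ^ (2 ^ (l - 1) + 1))⁻¹) (by simp [zdRels])
  rw [map_mul, map_inv, mul_inv_eq_one, map_mul, map_inv, mul_inv_eq_iff_eq_mul, map_mul,
    map_pow] at h
  exact h

theorem v_mul_a : v k l * a k l = a k l ^ (2 ^ (l - 1) - 1) * v k l := by
  have h := rel k l (w := FreeGroup.of .v * FreeGroup.of .a * FreeGroup.of .v *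
    (FreeGroup.of .a ^ (2 ^ (l - 1) - 1))⁻¹) (by simp [zdRels])
  rw [map_mul, map_inv, mul_inv_eq_one, map_mul, map_mul, map_pow] at h
  have h' : v k l * a k l * v k l = a k l ^ (2 ^ (l - 1) - 1) := h
  rw [← h', mul_assoc, ← sq, v_sq, mul_one]

theorem v_mul_u : v k l * u k l = (u k l)⁻¹ * v k l := by
  have h := rel k l (w := FreeGroup.of .v * FreeGroup.of .u * FreeGroup.of .v * FreeGroup.of .u)
    (by simp [zdRels])
  rw [map_mul, map_mul, map_mul] at h
  have h' : v k l * u k l * v k l * u k l = 1 := h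
  rw [← eq_inv_of_mul_eq_one_left h', mul_assoc, ← sq, v_sq, mul_one]

theorem u_mul_a_zpow (n : ℤ) :
    u k l * a k l ^ n = a k l ^ (((2 ^ (l - 1) + 1 : ℕ) : ℤ) * n) * u k l := by
  have h : SemiconjBy (u k l) (a k l) (a k l ^ (2 ^ (l - 1) + 1)) := u_mul_a k l
  rw [zpow_mul, zpow_natCast]
  exact (h.zpow_right n).eq

theorem v_mul_a_zpow (n : ℤ) :
    v k l * a k l ^ n = a k l ^ (((2 ^ (l - 1) - 1 : ℕ) : ℤ) * n) * v k l := by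
  have h : SemiconjBy (v k l) (a k l) (a k l ^ (2 ^ (l - 1) - 1)) := v_mul_a k l
  rw [zpow_mul, zpow_natCast]
  exact (h.zpow_right n).eq

theorem v_mul_u_zpow (n : ℤ) : v k l * u k l ^ n = u k l ^ (-n) * v k l := by
  have h : SemiconjBy (v k l) (u k l) (u k l)⁻¹ := v_mul_u k l
  rw [zpow_neg, ← inv_zpow]
  exact (h.zpow_right n).eq

theorem exists_normal_form [NeZero k] (g : ZD k l) :
    ∃ p q r : ℤ, g = a k l ^ p * u k l ^ q * v k l ^ r := by
  have hg : g ∈ Subgroup.closure (Set.range (PresentedGroup.of (rels := zdRels k l))) := by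
    rw [PresentedGroup.closure_range_of]; trivial
  have ha : ∀ p q r : ℤ, ∃ p' q' r' : ℤ,
      a k l * (a k l ^ p * u k l ^ q * v k l ^ r) = a k l ^ p' * u k l ^ q' * v k l ^ r' :=
    fun p q r => ⟨1 + p, q, r, by rw [zpow_add, zpow_one]; simp only [mul_assoc]⟩
  have hu : ∀ p q r : ℤ, ∃ p' q' r' : ℤ,
      u k l * (a k l ^ p * u k l ^ q * v k l ^ r) = a k l ^ p' * u k l ^ q' * v k l ^ r' :=
    fun p q r => ⟨((2 ^ (l - 1) + 1 : ℕ) : ℤ) * p, 1 + q, r, by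
      rw [← mul_assoc, ← mul_assoc, u_mul_a_zpow, zpow_add (u k l),
        zpow_one (u k l)]
      simp only [mul_assoc]⟩
  have hv : ∀ p q r : ℤ, ∃ p' q' r' : ℤ,
      v k l * (a k l ^ p * u k l ^ q * v k l ^ r) = a k l ^ p' * u k l ^ q' * v k l ^ r' :=
    fun p q r => ⟨((2 ^ (l - 1) - 1 : ℕ) : ℤ) * p, -q, 1 + r, by
      rw [← mul_assoc, ← mul_assoc, v_mul_a_zpow, mul_assoc (a k l ^ _), v_mul_u_zpow,
        zpow_add (v k l), zpow_one (v k l)]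
      simp only [mul_assoc]⟩
  have hx : ∀ x ∈ Set.range (PresentedGroup.of (rels := zdRels k l)), ∀ n : ℕ,
      ∀ p q r : ℤ, ∃ p' q' r' : ℤ,
      x ^ n * (a k l ^ p * u k l ^ q * v k l ^ r) = a k l ^ p' * u k l ^ q' * v k l ^ r' := by
    rintro _ ⟨i, rfl⟩ n
    induction n with
    | zero => exact fun p q r => ⟨p, q, r, by simp⟩
    | succ n ih =>
      intro p q r
      obtain ⟨p₁, q₁, r₁, h₁⟩ := ih p q r
      rw [pow_succ', mul_assoc, h₁]
      cases i
      · exact ha _ _ _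
      · exact hu _ _ _
      · exact hv _ _ _
  have hinv : ∀ x ∈ Set.range (PresentedGroup.of (rels := zdRels k l)),
      ∃ n : ℕ, x⁻¹ = x ^ n := by
    have aux : ∀ (x : ZD k l) (n : ℕ), n ≠ 0 → x ^ n = 1 → ∃ n : ℕ, x⁻¹ = x ^ n := by
      intro x n hn h
      refine ⟨n - 1, inv_eq_of_mul_eq_one_right ?_⟩
      rw [← pow_succ', Nat.sub_add_cancel (Nat.one_le_iff_ne_zero.mpr hn), h]
    rintro _ ⟨i, rfl⟩
    cases i
    · exact aux _ _ (by positivity) (a_pow k l)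
    · exact aux _ _ (NeZero.ne k) (u_pow k l)
    · exact aux _ 2 two_ne_zero (v_sq k l)
  induction hg using Subgroup.closure_induction_left with
  | one => exact ⟨0, 0, 0, by simp⟩
  | mul_left x hx' y hy ih =>
    obtain ⟨p, q, r, rfl⟩ := ih
    simpa using hx x hx' 1 p q r
  | inv_mul_cancel x hx' y hy ih =>
    obtain ⟨p, q, r, rfl⟩ := ih
    obtain ⟨n, hn⟩ := hinv x hx'
    rw [hn]
    exact hx x hx' n p q r

instance [NeZero k] : Finite (ZD k l) := by
  have fin : ∀ (x : ZD k l) (n : ℕ), n ≠ 0 → x ^ n = 1 →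
      (Subgroup.zpowers x : Set (ZD k l)).Finite := by
    intro x n hn h
    have : IsOfFinOrder x := isOfFinOrder_iff_pow_eq_one.mpr ⟨n, Nat.pos_of_ne_zero hn, h⟩
    exact this.finite_zpowers
  have h1 := fin (a k l) (2 ^ l) (by positivity) (a_pow k l)
  have h2 := fin (u k l) k (NeZero.ne k) (u_pow k l)
  have h3 := fin (v k l) 2 two_ne_zero (v_sq k l)
  refine Set.finite_univ_iff.mp (((h1.image2 (· * ·) h2).image2 (· * ·) h3).subset ?_)
  intro g _
  obtain ⟨p, q, r, rfl⟩ := exists_normal_form k l g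
  exact ⟨_, ⟨_, ⟨p, rfl⟩, _, ⟨q, rfl⟩, rfl⟩, _, ⟨r, rfl⟩, rfl⟩

instance [NeZero k] : Fintype (ZD k l) := Fintype.ofFinite _

end ZD

end

/-! Computing Sweedler powers on the basis of the double and tracing over the class gives
(`indicator_classModule`) `ν_m(V) = |class(s)|/|G| · ∑ η(x^m)`, summed over the `x` with `(x s)^m =
x^m`. It remains to find these `x` for `s = a^r u^b`, `b` odd, whose class has four elements.

Let `K = ⟨a, u⟩`, realised as the kernel of `vParity`; it has index two. Put `z = a^{2^{l-1}}`, a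
central involution. Commutators in `K` and squares of elements outside `K` lie in `{1, z}`, so
everything becomes parity bookkeeping on exponents.

If `m` is odd, counting `u` modulo 2 shows that no `x` qualifies. If `m ≡ 2 mod 4`, the dihedral
quotient excludes `x ∈ K`, while `x = y v` with `y ∈ K` qualifies exactly when `y` centralizes `s`,
and then `x^m = 1`; the sum is `|C_G(s)|` and the indicator is 1.

If `4 ∣ m`, every `x ∉ K` has `x^m = (x s)^m = 1`, and this coset contributes 2. On `K` the `m`-th
power map is a homomorphism, so the condition becomes `s^m = 1`, and the sum of the character `x ↦
η(x^m)` over `K` is `|K|` or 0. This adds 2 precisely when `s^m = 1` and `η^{m/2}` is trivial on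
`⟨a², u²⟩`, the subgroup generated by the squares of `K`. -/

/-! ### Sweedler powers in the double of a finite group -/

namespace DrinfeldDouble

variable {G : Type*} [Group G] [Fintype G]

open Classical in
/-- The Sweedler powers of the basis elements of the double of a finite group. -/
theorem sweedlerPow_bas (m : ℕ) (h x : G) :
    sweedlerPow (DrinfeldDouble G) m (bas h x) =
      ∑ g : G, if (x * g) ^ m = x ^ m * h then bas g (x ^ m) else 0 := by
  induction m generalizing h with
  | zero =>
    simp only [sweedlerPow, LinearMap.comp_apply, counit_bas, Algebra.linearMap_apply, pow_zero,
      one_mul, eq_comm (a := (1 : G))]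
    split_ifs <;> simp [one_def]
  | succ m ih =>
    simp only [sweedlerPow, LinearMap.comp_apply, comul_bas, map_sum, TensorProduct.map_tmul,
      LinearMap.id_apply, LinearMap.mul'_apply, ih, Finset.sum_mul, ite_mul, zero_mul, bas_mul_bas]
    rw [Finset.sum_comm]
    refine Finset.sum_congr rfl fun g _ => ?_
    -- The product of `p_g ⋈ x^m` and `p_t ⋈ x` vanishes unless `g = x^m t x^{-m}`, which determines
    -- `t`.
    rw [Finset.sum_eq_single ((x ^ m)⁻¹ * g * x ^ m)]
    · have e : (x * g) ^ m = x ^ m * (((x ^ m)⁻¹ * g * x ^ m)⁻¹ * h) ↔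
          (x * g) ^ (m + 1) = x ^ (m + 1) * h := by
        -- Moving the factor `x g` to the other side raises the exponent in the condition from `m`
        -- to `m + 1`.
        have e1 : x ^ m * (((x ^ m)⁻¹ * g * x ^ m)⁻¹ * h) = (x * g)⁻¹ * (x ^ (m + 1) * h) := by
          rw [pow_succ' x m]; group
        rw [e1, eq_inv_mul_iff_mul_eq, ← pow_succ']
      rw [if_pos (by group : g = x ^ m * ((x ^ m)⁻¹ * g * x ^ m) * (x ^ m)⁻¹)]
      simp only [e, pow_succ]
    · intro t _ ht
      rw [if_neg (c := g = x ^ m * t * (x ^ m)⁻¹), ite_self]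
      rintro rfl
      exact ht (by group)
    · simp

end DrinfeldDouble

/-! ### Characters, indicators and irreducibility of `M(class(s), η)` -/

section LinearCharacter

variable {G : Type*} [Group G] {s : G}

open Classical in
/-- A linear character of a subgroup, extended by zero to the whole group. -/
noncomputable def extendByZero {C : Subgroup G} (η : C →* ℂˣ) (y : G) : ℂ :=
  if h : y ∈ C then (η ⟨y, h⟩ : ℂ) else 0

theorem extendByZero_of_mem {C : Subgroup G} (η : C →* ℂˣ) {y : G} (h : y ∈ C) :
    extendByZero η y = (η ⟨y, h⟩ : ℂ) := dif_pos h

theorem extendByZero_one {C : Subgroup G} (η : C →* ℂˣ) : extendByZero η 1 = 1 := by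
  rw [extendByZero_of_mem η C.one_mem]
  exact congrArg Units.val (map_one η)

variable (η : Subgroup.centralizer ({s} : Set G) →* ℂˣ)

theorem linearRep_apply {C : Type*} [Group C] (η : C →* ℂˣ) (c : C) (w : ℂ) :
    linearRep η c w = (η c : ℂ) * w := by
  change ((η c : ℂ) • LinearMap.id (R := ℂ)) w = _
  rw [LinearMap.smul_apply, LinearMap.id_apply, smul_eq_mul]

/-- The standard basis of `M(class(s), η)` for a linear character `η`. -/
noncomputable def classBasis [Finite G] :
    Module.Basis (conjugatesOf s) ℂ (ClassModule s (linearRep η)) :=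
  Pi.basisFun ℂ (conjugatesOf s)

theorem finrank_classModule [Finite G] :
    Module.finrank ℂ (ClassModule s (linearRep η)) = Nat.card (conjugatesOf s) :=
  Module.finrank_eq_nat_card_basis (classBasis η)

/-- The conjugacy class of `s` and the centralizer of `s` have complementary sizes. -/
theorem card_conjugatesOf_mul_card_centralizer {G : Type*} [Group G] [Finite G] (s : G) :
    Nat.card (conjugatesOf s) * Nat.card (Subgroup.centralizer ({s} : Set G)) = Nat.card G := by
  classical
  have := Fintype.ofFinite G
  have : Fintype (ConjAct G) := Fintype.ofEquiv G ConjAct.toConjAct.toEquiv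
  have : Fintype (MulAction.orbit (ConjAct G) s) := Fintype.ofFinite _
  have : Fintype (MulAction.stabilizer (ConjAct G) s) := Fintype.ofFinite _
  have h := MulAction.card_orbit_mul_card_stabilizer_eq_card_group (ConjAct G) s
  rw [← Nat.card_eq_fintype_card, ← Nat.card_eq_fintype_card, ← Nat.card_eq_fintype_card,
    ConjAct.orbit_eq_carrier_conjClasses] at h
  rw [Subgroup.nat_card_centralizer_nat_card_stabilizer]
  exact h

variable [Fintype G]

-- The basis of the double acts by partial monomial matrices with entries given by `η` on the
-- cocycle; both the traces and the irreducibility are read off from this.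
open Classical in
theorem classBasis_repr_bas_smul (g x : G) (f : ClassModule s (linearRep η)) (t : conjugatesOf s) :
    (classBasis η).repr (DrinfeldDouble.bas g x • f) t =
      if (t : G) = g then (η (cocycle x (conjClassAct x⁻¹ t)) : ℂ) *
        (classBasis η).repr f (conjClassAct x⁻¹ t) else 0 := by
  have h : ClassModule.toEnd (linearRep η) (DrinfeldDouble.bas g x) =
      ClassModule.gradeProj (linearRep η) g * ClassModule.groupAct (linearRep η) x := by
    have h' : ClassModule.toEnd (linearRep η) (DrinfeldDouble.bas g x) =
        DrinfeldDouble.lift (fun g x => ClassModule.gradeProj (linearRep η) g *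
          ClassModule.groupAct (linearRep η) x) (DrinfeldDouble.bas g x) := rfl
    rw [h', DrinfeldDouble.lift_bas]
  rw [ClassModule.smul_def, h]
  change (if (t : G) = g then linearRep η (cocycle x (conjClassAct x⁻¹ t))
    ((classBasis η).repr f (conjClassAct x⁻¹ t)) else 0) = _
  rw [linearRep_apply]

-- A diagonal entry at `t` survives only if `y` commutes with `t`, that is, if `g_t⁻¹ y g_t`
-- centralizes `s`; extending `η` by zero absorbs this condition.
open Classical in
theorem moduleCharacter_bas (g y : G) :
    moduleCharacter (DrinfeldDouble G) (ClassModule s (linearRep η)) (DrinfeldDouble.bas g y) =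
      ∑ t : conjugatesOf s, if (t : G) = g then
        extendByZero η ((conjRep s t)⁻¹ * y * conjRep s t) else 0 := by
  rw [moduleCharacter, LinearMap.trace_eq_matrix_trace ℂ (classBasis η), Matrix.trace]
  refine Finset.sum_congr rfl fun t _ => ?_
  rw [Matrix.diag_apply, LinearMap.toMatrix_apply]
  change (classBasis η).repr (DrinfeldDouble.bas g y • classBasis η t) t = _
  rw [classBasis_repr_bas_smul, Module.Basis.repr_self, Finsupp.single_apply]
  simp only [eq_comm (a := t)]
  refine if_congr Iff.rfl ?_ rfl
  have hs := conjRep_spec s t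
  split_ifs with h
  · have hc : ((cocycle y (conjClassAct y⁻¹ t) : Subgroup.centralizer ({s} : Set G)) : G) =
        (conjRep s t)⁻¹ * y * conjRep s t := by
      change (conjRep s (conjClassAct y (conjClassAct y⁻¹ t)))⁻¹ * y *
        conjRep s (conjClassAct y⁻¹ t) = _
      rw [conjClassAct_inv, h]
    rw [← hc, extendByZero_of_mem η (cocycle y (conjClassAct y⁻¹ t)).2, mul_one]
  · rw [mul_zero, extendByZero, dif_neg]
    intro hm
    apply h
    rw [Subgroup.mem_centralizer_singleton_iff] at hm
    refine Subtype.ext ?_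
    change y⁻¹ * t * y⁻¹⁻¹ = t
    rw [inv_inv, mul_assoc, inv_mul_eq_iff_eq_mul, ← hs]
    have := congrArg (fun w => conjRep s t * w * (conjRep s t)⁻¹) hm
    simp only [mul_assoc, mul_inv_cancel_left] at this ⊢
    simpa using this.symm

open Classical in
/-- The indicators of `M(class(s), η)` for a linear character `η`. -/
theorem indicator_classModule (m : ℕ) :
    indicator (DrinfeldDouble G) (ClassModule s (linearRep η)) m =
      (Fintype.card G : ℂ)⁻¹ * (Nat.card (conjugatesOf s) *
        ∑ x : G, if (x * s) ^ m = x ^ m then extendByZero η (x ^ m) else 0) := by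
  have hadd : ∀ d : DrinfeldDouble G,
      moduleCharacter (DrinfeldDouble G) (ClassModule s (linearRep η)) d =
      (LinearMap.trace ℂ (ClassModule s (linearRep η)) ∘ₗ
        (Algebra.lsmul ℂ ℂ (ClassModule s (linearRep η))).toLinearMap) d := fun _ => rfl
  rw [indicator, DrinfeldDouble.normalizedIntegral_eq, map_smul, map_sum, hadd, map_smul,
    map_sum, smul_eq_mul]
  congr 1
  simp only [DrinfeldDouble.sweedlerPow_bas, map_sum, mul_one]
  have h1 : ∀ x : G, ∑ g : G, (LinearMap.trace ℂ (ClassModule s (linearRep η)) ∘ₗ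
        (Algebra.lsmul ℂ ℂ (ClassModule s (linearRep η))).toLinearMap)
        (if (x * g) ^ m = x ^ m then DrinfeldDouble.bas g (x ^ m) else 0) =
      ∑ t : conjugatesOf s, if (x * t) ^ m = x ^ m then
        extendByZero η ((conjRep s t)⁻¹ * x ^ m * conjRep s t) else 0 := by
    intro x
    have h2 : ∀ g : G, (LinearMap.trace ℂ (ClassModule s (linearRep η)) ∘ₗ
        (Algebra.lsmul ℂ ℂ (ClassModule s (linearRep η))).toLinearMap)
        (if (x * g) ^ m = x ^ m then DrinfeldDouble.bas g (x ^ m) else 0) =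
        ∑ t : conjugatesOf s, if (t : G) = g then (if (x * g) ^ m = x ^ m then
          extendByZero η ((conjRep s t)⁻¹ * x ^ m * conjRep s t) else 0) else 0 := by
      intro g
      split_ifs with hg
      · exact (hadd _).symm.trans (moduleCharacter_bas η g (x ^ m))
      · simp
    simp only [h2]
    rw [Finset.sum_comm]
    simp
  simp only [h1]
  rw [Finset.sum_comm, Nat.card_eq_fintype_card, ← nsmul_eq_mul, ← Finset.card_univ,
    ← Finset.sum_const]
  refine Finset.sum_congr rfl fun t _ => ?_
  -- Substituting `g_t x g_t⁻¹` for `x` turns the sum for `t` into the sum for `s`, so all members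
  -- of the class contribute equally.
  rw [← Equiv.sum_comp (MulAut.conj (conjRep s t)).toEquiv]
  refine Finset.sum_congr rfl fun x _ => ?_
  have hx : (MulAut.conj (conjRep s t)).toEquiv x = MulAut.conj (conjRep s t) x := rfl
  have ht : (t : G) = MulAut.conj (conjRep s t) s := (conjRep_spec s t).symm
  rw [hx]
  refine if_congr ?_ ?_ rfl
  · rw [ht, ← map_mul, ← map_pow, ← map_pow, EmbeddingLike.apply_eq_iff_eq]
  · rw [← map_pow, MulAut.conj_apply]
    congr 1
    group

/-- `M(class(s), η)` is irreducible for a linear character `η`. -/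
theorem isSimpleModule_classModule :
    IsSimpleModule (DrinfeldDouble G) (ClassModule s (linearRep η)) := by
  classical
  -- Up to a nonzero scalar, `p_{t'} ⋈ x` with `x t x⁻¹ = t'` is a matrix unit: it extracts the
  -- coordinate at `t` and moves it to `t'`. Hence a nonzero submodule contains every basis vector.
  have hbas : ∀ (t t' : conjugatesOf s) (f : ClassModule s (linearRep η)), ∃ (d : DrinfeldDouble G)
      (c : ℂ), c ≠ 0 ∧ d • f = (c * (classBasis η).repr f t) • classBasis η t' := by
    intro t t' f
    obtain ⟨x, hx⟩ := isConj_iff.mp (t.2.symm.trans t'.2)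
    have hx' : conjClassAct x⁻¹ t' = t := by
      refine Subtype.ext ?_
      change x⁻¹ * t' * x⁻¹⁻¹ = t
      rw [← hx]; group
    refine ⟨DrinfeldDouble.bas (t' : G) x, η (cocycle x t), Units.ne_zero _, (classBasis η).ext_elem fun w => ?_⟩
    rw [classBasis_repr_bas_smul, map_smul, Finsupp.smul_apply, Module.Basis.repr_self,
      Finsupp.single_apply, smul_eq_mul]
    by_cases hw : w = t'
    · subst hw
      simp [hx']
    · rw [if_neg (fun h => hw (Subtype.ext h)), if_neg (fun h => hw h.symm),
        mul_zero]
  let t₀ : conjugatesOf s := ⟨s, IsConj.refl s⟩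
  have : Nontrivial (ClassModule s (linearRep η)) := ⟨classBasis η t₀, 0, (classBasis η).ne_zero t₀⟩
  have hnt : Nontrivial (Submodule (DrinfeldDouble G) (ClassModule s (linearRep η))) :=
    Submodule.nontrivial_iff _ |>.mpr this
  refine isSimpleModule_iff _ _ |>.mpr ⟨fun N => or_iff_not_imp_left.mpr fun hN => ?_⟩
  obtain ⟨f, hf, hf0⟩ := N.ne_bot_iff.mp hN
  obtain ⟨t, ht⟩ : ∃ t, (classBasis η).repr f t ≠ 0 := by
    by_contra! h
    exact hf0 ((classBasis η).ext_elem fun t => by rw [h t, map_zero, Finsupp.zero_apply])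
  have hmem : ∀ t', classBasis η t' ∈ N.restrictScalars ℂ := by
    intro t'
    obtain ⟨d, c, hc, hd⟩ := hbas t t' f
    have h1 : (c * (classBasis η).repr f t) • classBasis η t' ∈ N.restrictScalars ℂ := hd ▸ N.smul_mem d hf
    exact ((N.restrictScalars ℂ).smul_mem_iff (mul_ne_zero hc ht)).mp h1
  refine Submodule.restrictScalars_injective ℂ _ _ (eq_top_iff.mpr ?_)
  rw [← (classBasis η).span_eq, Submodule.span_le]
  rintro _ ⟨t', rfl⟩
  exact hmem t'

end LinearCharacter

/-! ### Homomorphisms out of the presented group, and the orders of its elements -/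

namespace ZD

section Homs

variable {k l : ℕ} {M : Type*} [Group M]

/-- The homomorphism out of `ℤ_{2^l} ⋊ D_k` given by images of the generators. -/
def liftHom (x y w : M) (h1 : x ^ 2 ^ l = 1) (h2 : y ^ k = 1) (h3 : w ^ 2 = 1)
    (h4 : y * x * y⁻¹ * (x ^ (2 ^ (l - 1) + 1))⁻¹ = 1)
    (h5 : w * x * w * (x ^ (2 ^ (l - 1) - 1))⁻¹ = 1) (h6 : w * y * w * y = 1) : ZD k l →* M :=
  PresentedGroup.toGroup (f := fun | .a => x | .u => y | .v => w) (by
    intro t ht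
    simp only [zdRels, Set.mem_insert_iff, Set.mem_singleton_iff] at ht
    rcases ht with rfl | rfl | rfl | rfl | rfl | rfl <;>
      simpa only [map_mul, map_pow, map_inv, FreeGroup.lift_apply_of])

variable {x y w : M} {h1 : x ^ 2 ^ l = 1} {h2 : y ^ k = 1} {h3 : w ^ 2 = 1}
    {h4 : y * x * y⁻¹ * (x ^ (2 ^ (l - 1) + 1))⁻¹ = 1}
    {h5 : w * x * w * (x ^ (2 ^ (l - 1) - 1))⁻¹ = 1} {h6 : w * y * w * y = 1}

@[simp] theorem liftHom_a : liftHom x y w h1 h2 h3 h4 h5 h6 (a k l) = x :=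
  PresentedGroup.toGroup.of _

@[simp] theorem liftHom_u : liftHom x y w h1 h2 h3 h4 h5 h6 (u k l) = y :=
  PresentedGroup.toGroup.of _

@[simp] theorem liftHom_v : liftHom x y w h1 h2 h3 h4 h5 h6 (v k l) = w :=
  PresentedGroup.toGroup.of _

end Homs

variable (k l : ℕ)

/-- The projection onto the dihedral group. -/
def toDihedral : ZD k l →* DihedralGroup k :=
  liftHom 1 (.r 1) (.sr 0) (one_pow _) DihedralGroup.r_one_pow_n
    (by rw [sq, DihedralGroup.sr_mul_self]) (by simp) (by simp)
    (by simp)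

/-- The parity of the number of letters `v`. -/
def vParity : ZD k l →* Multiplicative (ZMod 2) :=
  liftHom 1 1 (Multiplicative.ofAdd 1) (by simp) (by simp) (by decide) (by simp)
    (by simp; decide) (by simp; decide)

/-- The parity of the number of letters `u`. -/
def uParity (hk : 2 ∣ k) : ZD k l →* Multiplicative (ZMod 2) :=
  liftHom 1 (Multiplicative.ofAdd 1) 1 (by simp)
    (by obtain ⟨j, rfl⟩ := hk
        rw [pow_mul, show (Multiplicative.ofAdd (1 : ZMod 2)) ^ 2 = 1 by decide, one_pow])
    (by simp) (by simp) (by simp) (by simp; decide)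

variable {l}

theorem two_pow_eq_zero : (2 : ZMod (2 ^ l)) ^ l = 0 := by
  exact_mod_cast ZMod.natCast_self (2 ^ l)

/-- Holds because `2(l - 1) ≥ l`. Together with `two_mul_half` it yields `n₁² = n₂² = 1` modulo
`2^l`, which makes the affine action `toPerm` possible. -/
theorem half_sq (hl : 2 ≤ l) : (2 : ZMod (2 ^ l)) ^ (l - 1) * 2 ^ (l - 1) = 0 := by
  rw [← pow_add, show l - 1 + (l - 1) = l + (l - 2) by omega, pow_add, two_pow_eq_zero, zero_mul]

theorem two_mul_half (hl : 2 ≤ l) : 2 * (2 : ZMod (2 ^ l)) ^ (l - 1) = 0 := by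
  rw [← pow_succ', Nat.sub_add_cancel (by omega), two_pow_eq_zero]

/-- The permutation of a commutative ring given by multiplication with a square root of `1`. -/
def mulPerm {R : Type*} [CommRing R] (n : R) (hn : n * n = 1) : Equiv.Perm R where
  toFun t := n * t
  invFun t := n * t
  left_inv t := by
    change n * (n * t) = t
    rw [← mul_assoc, hn, one_mul]
  right_inv t := by
    change n * (n * t) = t
    rw [← mul_assoc, hn, one_mul]

theorem addLeft_pow {R : Type*} [CommRing R] (n : ℕ) (t : R) :
    ((Equiv.addLeft (1 : R)) ^ n) t = n + t := by
  induction n generalizing t with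
  | zero => simp
  | succ n ih => rw [pow_succ, Equiv.Perm.mul_apply, ih]; simp; ring

/-- The action of `ℤ_{2^l} ⋊ D_k` on `ℤ_{2^l}` by affine maps. -/
def toPerm (hl : 2 ≤ l) (hk : 2 ∣ k) : ZD k l →* Equiv.Perm (ZMod (2 ^ l)) :=
  have hu : ((2 : ZMod (2 ^ l)) ^ (l - 1) + 1) * (2 ^ (l - 1) + 1) = 1 := by
    linear_combination half_sq hl + two_mul_half hl
  have hv : ((2 : ZMod (2 ^ l)) ^ (l - 1) - 1) * (2 ^ (l - 1) - 1) = 1 := by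
    linear_combination half_sq hl - two_mul_half hl
  liftHom (Equiv.addLeft 1) (mulPerm _ hu) (mulPerm _ hv)
    (by
      ext1 t
      rw [addLeft_pow]
      push_cast
      rw [two_pow_eq_zero, zero_add]
      rfl)
    (by
      obtain ⟨j, rfl⟩ := hk
      have : mulPerm _ hu ^ 2 = 1 := by
        ext1 t
        exact (mulPerm _ hu).left_inv t
      rw [pow_mul, this, one_pow])
    (by
      ext1 t
      exact (mulPerm _ hv).left_inv t)
    (by
      rw [mul_inv_eq_one, mul_inv_eq_iff_eq_mul]
      ext1 t
      rw [Equiv.Perm.mul_apply, Equiv.Perm.mul_apply, addLeft_pow]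
      change _ * (1 + t) = _ + _ * t
      push_cast
      ring)
    (by
      rw [mul_inv_eq_one]
      ext1 t
      rw [Equiv.Perm.mul_apply, Equiv.Perm.mul_apply, addLeft_pow]
      change _ * (1 + _ * t) = _ + t
      rw [Nat.cast_sub Nat.one_le_two_pow]
      push_cast
      linear_combination t * hv)
    (by
      ext1 t
      change _ * (_ * (_ * (_ * t))) = t
      linear_combination
        t * ((2 : ZMod (2 ^ l)) ^ (l - 1) + 1) * ((2 : ZMod (2 ^ l)) ^ (l - 1) + 1) * hv + t * hu)

variable {k}

/-- The relations do not shrink `⟨a⟩`: in the affine action `a` is translation by 1, and the image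
of 0 under `a^n` is `n`. -/
theorem a_zpow_eq_one_iff (hl : 2 ≤ l) (hk : 2 ∣ k) (p : ℤ) :
    a k l ^ p = 1 ↔ (2 : ℤ) ^ l ∣ p := by
  constructor
  · intro h
    obtain ⟨n, hn⟩ : ∃ n : ℕ, (n : ℤ) = p ∨ (n : ℤ) = -p := ⟨p.natAbs, by omega⟩
    have h' : a k l ^ n = 1 := by
      rw [← zpow_natCast]
      rcases hn with hn | hn <;> simp [hn, h]
    have h2 := congrArg (fun σ : Equiv.Perm (ZMod (2 ^ l)) => σ 0)
      (congrArg (toPerm k hl hk) h')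
    simp only [map_pow, map_one, toPerm, liftHom_a, addLeft_pow, add_zero,
      Equiv.Perm.one_apply] at h2
    have h3 : ((2 ^ l : ℕ) : ℤ) ∣ n := by
      exact_mod_cast (ZMod.natCast_eq_zero_iff _ _).mp h2
    push_cast at h3
    rcases hn with hn | hn
    · rwa [hn] at h3
    · rwa [hn, dvd_neg] at h3
  · rintro ⟨c, rfl⟩
    rw [zpow_mul]
    have := a_pow k l
    rw [show ((2 : ℤ) ^ l) = ((2 ^ l : ℕ) : ℤ) by push_cast; rfl, zpow_natCast, this, one_zpow]

theorem toDihedral_a_zpow_mul_u_zpow (p q : ℤ) :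
    toDihedral k l (a k l ^ p * u k l ^ q) = .r q := by
  simp [toDihedral]

theorem toDihedral_a_zpow_mul_u_zpow_mul_v (p q : ℤ) :
    toDihedral k l (a k l ^ p * u k l ^ q * v k l) = .sr (-q) := by
  rw [map_mul, toDihedral_a_zpow_mul_u_zpow]
  simp [toDihedral]

/-- The dihedral quotient kills `a` and detects `q` modulo `k`; once `u^q` is gone, the order of `a`
detects `p`. -/
theorem a_zpow_mul_u_zpow_eq_one_iff (hl : 2 ≤ l) (hk : 2 ∣ k) (p q : ℤ) :
    a k l ^ p * u k l ^ q = 1 ↔ (2 : ℤ) ^ l ∣ p ∧ (k : ℤ) ∣ q := by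
  have hu : (k : ℤ) ∣ q → u k l ^ q = 1 := by
    rintro ⟨c, rfl⟩
    rw [zpow_mul, zpow_natCast, u_pow, one_zpow]
  constructor
  · intro h
    have h1 := congrArg (toDihedral k l) h
    rw [toDihedral_a_zpow_mul_u_zpow, map_one, DihedralGroup.one_def, DihedralGroup.r.injEq,
      ZMod.intCast_zmod_eq_zero_iff_dvd] at h1
    rw [hu h1, mul_one, a_zpow_eq_one_iff hl hk] at h
    exact ⟨h, h1⟩
  · rintro ⟨h1, h2⟩
    rw [hu h2, mul_one, a_zpow_eq_one_iff hl hk]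
    exact h1

/-! ### Calculus with the words `z^c a^p u^q` -/

variable (k l : ℕ)

/-- The central involution `a^{2^{l-1}}`. -/
def z : ZD k l := a k l ^ 2 ^ (l - 1)

/-- The element `z^c a^p u^q`. -/
def zau (c p q : ℤ) : ZD k l := z k l ^ c * a k l ^ p * u k l ^ q

variable {k l}

theorem a_half_mul_half (hl : 2 ≤ l) : a k l ^ (2 ^ (l - 1) * 2 ^ (l - 1)) = 1 := by
  rw [← pow_add, show l - 1 + (l - 1) = l + (l - 2) by omega, pow_add, pow_mul, a_pow, one_pow]

theorem z_sq (hl : 2 ≤ l) : z k l ^ 2 = 1 := by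
  rw [z, ← pow_mul, ← pow_succ, Nat.sub_add_cancel (by omega), a_pow]

theorem z_mul_z (hl : 2 ≤ l) : z k l * z k l = 1 := by
  rw [← sq, z_sq hl]

theorem z_inv (hl : 2 ≤ l) : (z k l)⁻¹ = z k l :=
  inv_eq_of_mul_eq_one_left (z_mul_z hl)

theorem z_zpow_even (hl : 2 ≤ l) {n : ℤ} (hn : 2 ∣ n) : z k l ^ n = 1 := by
  obtain ⟨j, rfl⟩ := hn
  rw [zpow_mul, show (2 : ℤ) = (2 : ℕ) from rfl, zpow_natCast, z_sq hl, one_zpow]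

theorem z_zpow_congr (hl : 2 ≤ l) {n n' : ℤ} (hn : 2 ∣ n - n') : z k l ^ n = z k l ^ n' := by
  rw [← mul_inv_eq_one, ← zpow_neg, ← zpow_add, ← sub_eq_add_neg, z_zpow_even hl hn]

theorem z_zpow_odd (hl : 2 ≤ l) {n : ℤ} (hn : ¬ 2 ∣ n) : z k l ^ n = z k l := by
  rw [z_zpow_congr hl (n' := 1) (by omega), zpow_one]

theorem z_zpow_eq_one_iff (hl : 2 ≤ l) (hk : 2 ∣ k) {n : ℤ} : z k l ^ n = 1 ↔ 2 ∣ n := by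
  refine ⟨fun h => ?_, z_zpow_even hl⟩
  by_contra hn
  rw [z_zpow_odd hl hn, z, ← zpow_natCast, a_zpow_eq_one_iff hl hk] at h
  have h' : 2 ^ l ∣ 2 ^ (l - 1) := by exact_mod_cast h
  have := (Nat.pow_dvd_pow_iff_le_right (by norm_num)).mp h'
  omega

theorem z_ne_one (hl : 2 ≤ l) (hk : 2 ∣ k) : z k l ≠ 1 := by
  intro h
  rw [← zpow_one (z k l), z_zpow_eq_one_iff hl hk] at h
  omega

theorem commute_z_a : Commute (z k l) (a k l) := (Commute.refl _).pow_left _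

theorem commute_z_u (hl : 2 ≤ l) : Commute (z k l) (u k l) := by
  have h := u_mul_a_zpow k l (2 ^ (l - 1) : ℕ)
  rw [← Nat.cast_mul, zpow_natCast, zpow_natCast, add_mul, pow_add, a_half_mul_half hl, one_mul,
    one_mul] at h
  exact h.symm

/-- Conjugation by `v` inverts `z`, since `n₂ 2^{l-1} ≡ -2^{l-1}` modulo `2^l`, and `z` is its own
inverse. -/
theorem commute_z_v (hl : 2 ≤ l) : Commute (z k l) (v k l) := by
  have h := v_mul_a_zpow k l (2 ^ (l - 1) : ℕ)
  have e : a k l ^ (((2 ^ (l - 1) - 1 : ℕ) : ℤ) * (2 ^ (l - 1) : ℕ)) = z k l := by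
    rw [Nat.cast_sub Nat.one_le_two_pow, sub_mul, ← Nat.cast_mul, Nat.cast_one, one_mul, zpow_sub,
      zpow_natCast, zpow_natCast, a_half_mul_half hl, one_mul]
    exact z_inv hl
  rw [e, zpow_natCast] at h
  exact h.symm

theorem u_mul_a' : u k l * a k l = z k l * a k l * u k l := by
  rw [u_mul_a, pow_succ]; rfl

theorem v_mul_a' : v k l * a k l = z k l * (a k l)⁻¹ * v k l := by
  rw [v_mul_a, pow_sub _ Nat.one_le_two_pow, pow_one]; rfl

theorem a_zpow_mul_u (hl : 2 ≤ l) (p : ℤ) :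
    a k l ^ p * u k l = z k l ^ p * u k l * a k l ^ p := by
  have h : SemiconjBy (u k l) (a k l) (z k l * a k l) := u_mul_a'
  have h' := (h.zpow_right p).eq
  rw [commute_z_a.mul_zpow] at h'
  rw [mul_assoc, h', ← mul_assoc, ← mul_assoc, ← zpow_add, z_zpow_even hl (by omega), one_mul]

theorem a_zpow_mul_u_zpow (hl : 2 ≤ l) (p q : ℤ) :
    a k l ^ p * u k l ^ q = z k l ^ (p * q) * u k l ^ q * a k l ^ p := by
  have h : SemiconjBy (a k l ^ p) (u k l) (z k l ^ p * u k l) := a_zpow_mul_u hl p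
  rw [(h.zpow_right q).eq, ((commute_z_u hl).zpow_left p).mul_zpow, zpow_mul]

theorem v_mul_a_zpow' (p : ℤ) :
    v k l * a k l ^ p = z k l ^ p * a k l ^ (-p) * v k l := by
  have h : SemiconjBy (v k l) (a k l) (z k l * (a k l)⁻¹) := v_mul_a'
  rw [(h.zpow_right p).eq, commute_z_a.inv_right.mul_zpow, inv_zpow']

/-- Moving `u^q` past `a^{p'}` costs `z^{q p'}`. The coordinate `c` is redundant, but keeping it
apart confines all corrections to an exponent that matters only modulo 2. -/
theorem zau_mul_zau (hl : 2 ≤ l) (c p q c' p' q' : ℤ) :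
    zau k l c p q * zau k l c' p' q' = zau k l (c + c' + q * p') (p + p') (q + q') := by
  have e1 : u k l ^ q * a k l ^ p' = z k l ^ (q * p') * (a k l ^ p' * u k l ^ q) := by
    rw [a_zpow_mul_u_zpow hl, ← mul_assoc, ← mul_assoc, ← zpow_add,
      z_zpow_even hl ⟨q * p', by ring⟩, one_mul]
  have hu (i j : ℤ) : u k l ^ i * z k l ^ j = z k l ^ j * u k l ^ i :=
    ((commute_z_u hl).zpow_zpow j i).symm
  have ha (i j : ℤ) : a k l ^ i * z k l ^ j = z k l ^ j * a k l ^ i :=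
    (commute_z_a.zpow_zpow j i).symm
  calc zau k l c p q * zau k l c' p' q'
      = z k l ^ c * a k l ^ p * (u k l ^ q * z k l ^ c') * a k l ^ p' * u k l ^ q' := by
        simp only [zau, mul_assoc]
    _ = z k l ^ c * (a k l ^ p * z k l ^ c') * (u k l ^ q * a k l ^ p') * u k l ^ q' := by
        rw [hu]; simp only [mul_assoc]
    _ = z k l ^ c * z k l ^ c' * (a k l ^ p * z k l ^ (q * p')) * a k l ^ p' *
          (u k l ^ q * u k l ^ q') := by
        rw [ha, e1]; simp only [mul_assoc]
    _ = _ := by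
        rw [ha, zau, zpow_add, zpow_add, zpow_add, zpow_add]; simp only [mul_assoc]

theorem v_mul_zau (hl : 2 ≤ l) (c p q : ℤ) :
    v k l * zau k l c p q = zau k l (c + p) (-p) (-q) * v k l := by
  rw [zau, ← mul_assoc, ← mul_assoc, ← ((commute_z_v hl).zpow_left c).eq, mul_assoc (z k l ^ c),
    v_mul_a_zpow', mul_assoc, mul_assoc, mul_assoc, v_mul_u_zpow, zau, zpow_add]
  simp only [mul_assoc]

theorem v_mul_v : v k l * v k l = 1 := by rw [← sq, v_sq]

theorem zau_congr (hl : 2 ≤ l) {c c' : ℤ} (p q : ℤ) (h : 2 ∣ c - c') :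
    zau k l c p q = zau k l c' p q := by
  rw [zau, zau, z_zpow_congr hl h]

theorem zau_zero (p q : ℤ) : zau k l 0 p q = a k l ^ p * u k l ^ q := by
  rw [zau, zpow_zero, one_mul]

theorem zau_zero_zero (c : ℤ) : zau k l c 0 0 = z k l ^ c := by
  rw [zau, zpow_zero, zpow_zero, mul_one, mul_one]

theorem eq_zau_or_eq_zau_mul_v [NeZero k] (g : ZD k l) :
    ∃ p q : ℤ, g = zau k l 0 p q ∨ g = zau k l 0 p q * v k l := by
  obtain ⟨p, q, e, rfl⟩ := exists_normal_form k l g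
  refine ⟨p, q, ?_⟩
  rw [zau_zero]
  rcases Int.even_or_odd' e with ⟨j, rfl | rfl⟩
  · left
    rw [zpow_mul, show (2 : ℤ) = (2 : ℕ) from rfl, zpow_natCast, v_sq, one_zpow, mul_one]
  · right
    rw [zpow_add, zpow_mul, show (2 : ℤ) = (2 : ℕ) from rfl, zpow_natCast, v_sq, one_zpow, one_mul,
      zpow_one]

theorem zau_mul_zau_comm (hl : 2 ≤ l) (c p q c' p' q' : ℤ) :
    zau k l c p q * zau k l c' p' q' =
      z k l ^ (q * p' - q' * p) * zau k l c' p' q' * zau k l c p q := by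
  rw [mul_assoc, zau_mul_zau hl, zau_mul_zau hl, ← zau_zero_zero, zau_mul_zau hl]
  congr 1 <;> ring

/-- The commutator is `z` to the power of an alternating form in the exponents, and `z` has order
exactly two. -/
theorem commute_zau_iff (hl : 2 ≤ l) (hk : 2 ∣ k) (c p q c' p' q' : ℤ) :
    Commute (zau k l c p q) (zau k l c' p' q') ↔ 2 ∣ q * p' - q' * p := by
  rw [Commute, SemiconjBy, zau_mul_zau_comm hl, mul_assoc, mul_eq_right, z_zpow_eq_one_iff hl hk]

theorem toDihedral_z : toDihedral k l (z k l) = 1 := by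
  simp [z, toDihedral]

theorem toDihedral_zau (c p q : ℤ) : toDihedral k l (zau k l c p q) = .r q := by
  rw [zau, mul_assoc, map_mul, toDihedral_a_zpow_mul_u_zpow, map_zpow, toDihedral_z, one_zpow,
    one_mul]

theorem toDihedral_zau_mul_v (c p q : ℤ) :
    toDihedral k l (zau k l c p q * v k l) = .sr (-q) := by
  rw [zau, mul_assoc (z k l ^ c), mul_assoc (z k l ^ c), map_mul,
    toDihedral_a_zpow_mul_u_zpow_mul_v, map_zpow, toDihedral_z, one_zpow, one_mul]

/-- This separates the rotation by `b` from its inverse in the dihedral quotient, hence keeps the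
centralizer of `s` inside `⟨a, u⟩` and the class of `s` at full size. -/
theorem not_dvd_two_mul_of_odd (hk : 4 ∣ k) {b : ℤ} (hb : Odd b) : ¬ (k : ℤ) ∣ 2 * b := by
  intro h
  have h4 : (4 : ℤ) ∣ 2 * b := (by exact_mod_cast hk : (4 : ℤ) ∣ k).trans h
  obtain ⟨j, rfl⟩ := hb
  omega

theorem r_ne_r_neg (hk : 4 ∣ k) {b : ℤ} (hb : Odd b) :
    (DihedralGroup.r (b : ZMod k)) ≠ .r ((-b : ℤ) : ZMod k) := by
  intro h
  rw [DihedralGroup.r.injEq, ← sub_eq_zero, ← Int.cast_sub,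
    ZMod.intCast_zmod_eq_zero_iff_dvd] at h
  exact not_dvd_two_mul_of_odd hk hb (by convert h using 1; ring)

theorem not_commute_zau_mul_v (hk : 4 ∣ k) (c p q c' p' : ℤ) {b : ℤ} (hb : Odd b) :
    ¬ Commute (zau k l c p q * v k l) (zau k l c' p' b) := by
  intro h
  have h' := (h.map (toDihedral k l)).eq
  rw [toDihedral_zau_mul_v, toDihedral_zau, DihedralGroup.sr_mul_r, DihedralGroup.r_mul_sr,
    DihedralGroup.sr.injEq, ← sub_eq_zero] at h'
  apply not_dvd_two_mul_of_odd hk hb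
  rw [← ZMod.intCast_zmod_eq_zero_iff_dvd, ← h']
  push_cast
  ring

/-- The `m`-th power collects `z` to the exponent `m c + m(m-1)/2 · p q`, which is even for `4 ∣ m`.
-/
theorem zau_pow (hl : 2 ≤ l) {m : ℕ} (hm : 4 ∣ m) (c p q : ℤ) :
    zau k l c p q ^ m = zau k l 0 (m * p) (m * q) := by
  obtain ⟨n, rfl⟩ := hm
  induction n with
  | zero => simp [zau]
  | succ n ih =>
    rw [mul_add, pow_add, ih, show 4 * 1 = 1 + 1 + 1 + 1 from rfl, pow_add, pow_add, pow_add,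
      pow_one, zau_mul_zau hl, zau_mul_zau hl, zau_mul_zau hl, zau_mul_zau hl]
    push_cast
    rw [zau_congr hl (c' := 0)]
    · congr 1 <;> ring
    · ring_nf
      omega

/-- Conjugation by `v` inverts `z^c a^p u^q` up to a power of `z`, so only that power survives in
the square. -/
theorem zau_mul_v_sq (hl : 2 ≤ l) (c p q : ℤ) :
    (zau k l c p q * v k l) ^ 2 = z k l ^ (p * (1 + q)) := by
  rw [sq, mul_assoc, ← mul_assoc (v k l), v_mul_zau hl, mul_assoc, v_mul_v, mul_one,
    zau_mul_zau hl, add_neg_cancel, add_neg_cancel, zau_zero_zero]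
  exact z_zpow_congr hl ⟨c - q * p, by ring⟩

theorem zau_mul_v_mul_zau (hl : 2 ≤ l) (c p q c' p' q' : ℤ) :
    zau k l c p q * v k l * zau k l c' p' q' =
      zau k l (c + (c' + p') + q * -p') (p + -p') (q + -q') * v k l := by
  rw [mul_assoc, v_mul_zau hl, ← mul_assoc, zau_mul_zau hl]

theorem zau_conj_zau (hl : 2 ≤ l) (c p q c' p' q' : ℤ) :
    zau k l c p q * zau k l c' p' q' * (zau k l c p q)⁻¹ =
      z k l ^ (q * p' - q' * p) * zau k l c' p' q' := by
  rw [zau_mul_zau_comm hl, mul_inv_cancel_right]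

theorem z_zpow_eq_one_or (hl : 2 ≤ l) (n : ℤ) : z k l ^ n = 1 ∨ z k l ^ n = z k l := by
  by_cases hn : 2 ∣ n
  · exact .inl (z_zpow_even hl hn)
  · exact .inr (z_zpow_odd hl hn)

theorem v_conj_zau (hl : 2 ≤ l) (c p q : ℤ) :
    v k l * zau k l c p q * (v k l)⁻¹ = zau k l (c + p) (-p) (-q) := by
  rw [v_mul_zau hl, mul_inv_cancel_right]

/-! ### The conjugacy class of `a^r u^b` for odd `b` -/

theorem conjugatesOf_zau [NeZero k] (hl : 2 ≤ l) (r : ℤ) {b : ℤ} (hb : Odd b) :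
    conjugatesOf (zau k l 0 r b) = {zau k l 0 r b, z k l * zau k l 0 r b,
      zau k l r (-r) (-b), z k l * zau k l r (-r) (-b)} := by
  have hodd : ∀ {n : ℤ}, Odd n → z k l ^ n = z k l := fun {n} hn =>
    z_zpow_odd hl (by obtain ⟨j, rfl⟩ := hn; omega)
  have hv : v k l * zau k l 0 r b * (v k l)⁻¹ = zau k l r (-r) (-b) := by
    rw [v_conj_zau hl, zero_add]
  -- Conjugation by `a` multiplies by `z^{-q}`, which is `z` for odd `q`.
  have ha : ∀ c p : ℤ, ∀ {q : ℤ}, Odd q →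
      zau k l 0 1 0 * zau k l c p q * (zau k l 0 1 0)⁻¹ = z k l * zau k l c p q := by
    intro c p q hq
    rw [zau_conj_zau hl, hodd (by simpa using hq.neg)]
  have h2 : IsConj (zau k l 0 r b) (zau k l r (-r) (-b)) := isConj_iff.mpr ⟨_, hv⟩
  ext t
  simp only [Set.mem_insert_iff, Set.mem_singleton_iff]
  change IsConj (zau k l 0 r b) t ↔ _
  constructor
  · intro h
    obtain ⟨g, rfl⟩ := isConj_iff.mp h
    obtain ⟨p, q, rfl | rfl⟩ := eq_zau_or_eq_zau_mul_v g
    · rw [zau_conj_zau hl]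
      rcases z_zpow_eq_one_or (k := k) hl (q * r - b * p) with h | h <;> rw [h] <;> simp
    · have e : zau k l 0 p q * v k l * zau k l 0 r b * (zau k l 0 p q * v k l)⁻¹ =
          zau k l 0 p q * (v k l * zau k l 0 r b * (v k l)⁻¹) * (zau k l 0 p q)⁻¹ := by group
      rw [e, hv, zau_conj_zau hl]
      rcases z_zpow_eq_one_or (k := k) hl (q * -r - -b * p) with h | h <;> rw [h] <;> simp
  · rintro (rfl | rfl | rfl | rfl)
    · exact IsConj.refl _
    · exact isConj_iff.mpr ⟨_, ha _ _ hb⟩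
    · exact h2
    · exact h2.trans (isConj_iff.mpr ⟨_, ha _ _ hb.neg⟩)

/-- The factor `z ≠ 1` separates the elements within each pair, and the dihedral images `r^b ≠
r^{-b}` separate the two pairs. -/
theorem card_conjugatesOf_zau [NeZero k] (hl : 2 ≤ l) (hk : 4 ∣ k) (r : ℤ) {b : ℤ} (hb : Odd b) :
    Nat.card (conjugatesOf (zau k l 0 r b)) = 4 := by
  have hz : ∀ x : ZD k l, x ≠ z k l * x := fun x h =>
    z_ne_one hl ((by norm_num : 2 ∣ 4).trans hk) (right_eq_mul.mp h)
  have hd : ∀ x y : ZD k l, toDihedral k l x = .r (b : ZMod k) →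
      toDihedral k l y = .r ((-b : ℤ) : ZMod k) → x ≠ y := by
    rintro x _ hx hy rfl
    exact r_ne_r_neg hk hb (hx.symm.trans hy)
  have h1 : toDihedral k l (zau k l 0 r b) = .r (b : ZMod k) := toDihedral_zau _ _ _
  have h2 : toDihedral k l (z k l * zau k l 0 r b) = .r (b : ZMod k) := by
    rw [map_mul, toDihedral_z, one_mul, h1]
  have h3 : toDihedral k l (zau k l r (-r) (-b)) = .r ((-b : ℤ) : ZMod k) :=
    toDihedral_zau _ _ _
  have h4 : toDihedral k l (z k l * zau k l r (-r) (-b)) = .r ((-b : ℤ) : ZMod k) := by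
    rw [map_mul, toDihedral_z, one_mul, h3]
  rw [conjugatesOf_zau hl r hb, Nat.card_coe_set_eq, Set.ncard_insert_of_notMem,
    Set.ncard_insert_of_notMem, Set.ncard_pair (hz _)]
  · simp only [Set.mem_insert_iff, Set.mem_singleton_iff, not_or]
    exact ⟨hd _ _ h2 h3, hd _ _ h2 h4⟩
  · simp only [Set.mem_insert_iff, Set.mem_singleton_iff, not_or]
    exact ⟨hz _, hd _ _ h1 h3, hd _ _ h1 h4⟩

/-! ### The index-two subgroup `⟨a, u⟩` and the centralizer of `a^r u^b` -/

theorem zau_mem_ker_vParity (c p q : ℤ) : zau k l c p q ∈ (vParity k l).ker := by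
  simp [MonoidHom.mem_ker, zau, z, vParity]

theorem zau_mul_v_notMem_ker_vParity (c p q : ℤ) :
    zau k l c p q * v k l ∉ (vParity k l).ker := by
  rw [MonoidHom.mem_ker, map_mul, MonoidHom.mem_ker.mp (zau_mem_ker_vParity c p q), one_mul]
  simp only [vParity, liftHom_v]
  decide

theorem card_ker_vParity [NeZero k] : Nat.card (vParity k l).ker * 2 = Nat.card (ZD k l) := by
  have hs : Function.Surjective (vParity k l) := by
    intro t
    have ht : t = 1 ∨ t = Multiplicative.ofAdd 1 := by revert t; decide
    rcases ht with rfl | rfl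
    · exact ⟨1, map_one _⟩
    · exact ⟨v k l, liftHom_v⟩
  have h : (vParity k l).ker.index = 2 := by
    rw [Subgroup.index_ker, MonoidHom.range_eq_top.mpr hs, Subgroup.card_top,
      Nat.card_eq_fintype_card]
    rfl
  have h' := (vParity k l).ker.card_mul_index
  rwa [h] at h'

theorem zau_mem_centralizer_iff (hl : 2 ≤ l) (hk : 2 ∣ k) (c p q r b : ℤ) :
    zau k l c p q ∈ Subgroup.centralizer {zau k l 0 r b} ↔ 2 ∣ q * r - b * p := by
  rw [Subgroup.mem_centralizer_singleton_iff, ← commute_zau_iff hl hk]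
  rfl

theorem zau_mul_v_notMem_centralizer (hk : 4 ∣ k) (c p q r : ℤ) {b : ℤ} (hb : Odd b) :
    zau k l c p q * v k l ∉ Subgroup.centralizer {zau k l 0 r b} := by
  rw [Subgroup.mem_centralizer_singleton_iff]
  exact not_commute_zau_mul_v hk c p q 0 r hb

/-! ### Indicators for `m` not divisible by 4 -/

open Classical in
/-- The sum computing the indicators of `M(class(s), η)`. -/
theorem indicator_eq_sum [NeZero k] (hl : 2 ≤ l) (hk : 4 ∣ k) (r : ℤ) {b : ℤ} (hb : Odd b)
    (η : Subgroup.centralizer ({zau k l 0 r b} : Set (ZD k l)) →* ℂˣ) (m : ℕ) {S : ℂ}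
    (hS : 4 * (∑ x : ZD k l, if (x * zau k l 0 r b) ^ m = x ^ m then extendByZero η (x ^ m) else 0)
      = Fintype.card (ZD k l) * S) :
    indicator (DrinfeldDouble (ZD k l)) (ClassModule (zau k l 0 r b) (linearRep η)) m = S := by
  rw [indicator_classModule, card_conjugatesOf_zau hl hk r hb, Nat.cast_ofNat, hS,
    inv_mul_cancel_left₀ (Nat.cast_ne_zero.mpr Fintype.card_ne_zero)]

/-- The parity of `u` in `s` is odd, so `(x s)^m = x^m` would force `m` to be even: the sum is
empty. -/
theorem indicator_of_odd [NeZero k] (hl : 2 ≤ l) (hk : 4 ∣ k) (r : ℤ) {b : ℤ} (hb : Odd b)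
    (η : Subgroup.centralizer ({zau k l 0 r b} : Set (ZD k l)) →* ℂˣ) {m : ℕ} (hm : ¬ 2 ∣ m) :
    indicator (DrinfeldDouble (ZD k l)) (ClassModule (zau k l 0 r b) (linearRep η)) m = 0 := by
  have hk2 : 2 ∣ k := (by norm_num : 2 ∣ 4).trans hk
  apply indicator_eq_sum hl hk r hb
  rw [Finset.sum_eq_zero, mul_zero, mul_zero]
  intro x _
  rw [if_neg]
  intro h
  have h' := congrArg (uParity k l hk2) h
  have hs : uParity k l hk2 (zau k l 0 r b) = Multiplicative.ofAdd 1 := by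
    obtain ⟨j, rfl⟩ := hb
    have e : (Multiplicative.ofAdd (1 : ZMod 2)) ^ (2 * j + 1) = Multiplicative.ofAdd 1 := by
      rw [zpow_add, zpow_mul, show (Multiplicative.ofAdd (1 : ZMod 2)) ^ (2 : ℤ) = 1 by decide,
        one_zpow, one_mul, zpow_one]
    simpa [zau, uParity] using e
  rw [map_pow, map_mul, mul_pow, map_pow, mul_eq_left, hs, ← ofAdd_nsmul,
    ofAdd_eq_one, nsmul_eq_mul, mul_one, ZMod.natCast_eq_zero_iff] at h'
  exact hm h'

theorem indicator_of_two_dvd_of_not_four_dvd [NeZero k] (hl : 2 ≤ l) (hk : 4 ∣ k) (r : ℤ) {b : ℤ}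
    (hb : Odd b) (η : Subgroup.centralizer ({zau k l 0 r b} : Set (ZD k l)) →* ℂˣ) {m : ℕ}
    (hm : 2 ∣ m) (hm4 : ¬ 4 ∣ m) :
    indicator (DrinfeldDouble (ZD k l)) (ClassModule (zau k l 0 r b) (linearRep η)) m = 1 := by
  classical
  have hk2 : 2 ∣ k := (by norm_num : 2 ∣ 4).trans hk
  apply indicator_eq_sum hl hk r hb
  -- For `x = y v` with `y ∈ ⟨a, u⟩` one has `x v = y`, so the claim is that `x` contributes 1
  -- exactly when `y` centralizes `s`.
  have hF : ∀ x : ZD k l, (if (x * zau k l 0 r b) ^ m = x ^ m then extendByZero η (x ^ m) else 0) =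
      if x * v k l ∈ Subgroup.centralizer {zau k l 0 r b} then 1 else 0 := by
    intro x
    obtain ⟨p, q, rfl | rfl⟩ := eq_zau_or_eq_zau_mul_v x
    · rw [if_neg, if_neg (zau_mul_v_notMem_centralizer hk 0 p q r hb)]
      intro h
      -- Comparing rotations gives `k ∣ b m`, hence `4 ∣ b m`, impossible for `b` odd and `m ≡ 2 mod
      -- 4`.
      have h' := congrArg (toDihedral k l) h
      rw [map_pow, map_mul, map_pow, toDihedral_zau, toDihedral_zau, DihedralGroup.r_mul_r,
        DihedralGroup.r_pow, DihedralGroup.r_pow, DihedralGroup.r.injEq, add_mul,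
        add_eq_left] at h'
      have h2 : (k : ℤ) ∣ b * m := by
        rw [← ZMod.intCast_zmod_eq_zero_iff_dvd, ← h']
        push_cast
        rfl
      have h4 : (4 : ℤ) ∣ b * m := (by exact_mod_cast hk : (4 : ℤ) ∣ k).trans h2
      obtain ⟨n, rfl⟩ := hm
      have h5 : (2 : ℤ) ∣ b * n := by
        push_cast at h4
        obtain ⟨c, hc⟩ := h4
        exact ⟨c, by linarith⟩
      have h6 : (2 : ℤ) ∣ n := by
        rcases Int.prime_two.dvd_or_dvd h5 with h | h
        · obtain ⟨j, rfl⟩ := hb; omega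
        · exact h
      omega
    · obtain ⟨n, rfl⟩ := hm
      have hn : ¬ (2 : ℤ) ∣ n := by omega
      rw [zau_mul_v_mul_zau hl, pow_mul, pow_mul, zau_mul_v_sq hl, zau_mul_v_sq hl, mul_assoc _ (v k l),
        v_mul_v, mul_one, zau_mem_centralizer_iff hl hk2, ← zpow_natCast, ← zpow_natCast, ← zpow_mul,
        ← zpow_mul]
      -- With `n = m/2` odd, the two exponents differ modulo 2 by `q r - b p`, the commutator
      -- exponent of `y` and `s`.
      have key : z k l ^ ((p + -r) * (1 + (q + -b)) * n) = z k l ^ (p * (1 + q) * n) ↔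
          2 ∣ q * r - b * p := by
        rw [← mul_inv_eq_one, ← zpow_neg, ← zpow_add, z_zpow_eq_one_iff hl hk2]
        obtain ⟨j, rfl⟩ := hb
        have e : (p + -r) * (1 + (q + -(2 * j + 1))) * ↑n + -(p * (1 + q) * ↑n) =
            2 * ((r * j - p * j - q * r) * n) + (q * r - p) * n := by ring
        have e' : q * r - (2 * j + 1) * p = 2 * (-(j * p)) + (q * r - p) := by ring
        rw [e, e', Int.dvd_add_right ⟨_, rfl⟩, Int.dvd_add_right ⟨_, rfl⟩,
          Int.prime_two.dvd_mul, or_iff_left hn]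
      rw [if_congr key rfl rfl]
      split_ifs with h
      · rw [z_zpow_even hl, extendByZero_one]
        refine Dvd.dvd.mul_right ?_ _
        obtain ⟨j, rfl⟩ := hb
        -- When `y` centralizes `s`, `p ≡ q r` modulo 2, so `p (1 + q) ≡ q (q + 1) r` is even and
        -- `x^m = 1`.
        have e' : p * (1 + q) = 2 * (-(j * p) * (1 + q)) + q * (q + 1) * r -
          (q * r - (2 * j + 1) * p) * (1 + q) := by ring
        rw [e']
        refine dvd_sub (dvd_add ⟨_, rfl⟩ (Dvd.dvd.mul_right ?_ _)) (h.mul_right _)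
        exact (Int.even_mul_succ_self q).two_dvd
      · rfl
  -- Right translation by `v` makes the sum equal to `|C_G(s)|`, and `4 |C_G(s)| = |G|`.
  have hsum : (∑ x : ZD k l, if x * v k l ∈ Subgroup.centralizer {zau k l 0 r b} then (1 : ℂ) else 0)
      = ∑ x : ZD k l, if x ∈ Subgroup.centralizer {zau k l 0 r b} then 1 else 0 := by
    convert Equiv.sum_comp (Equiv.mulRight (v k l))
      (fun x => if x ∈ Subgroup.centralizer {zau k l 0 r b} then (1 : ℂ) else 0)
    rfl
  refine (congrArg (4 * ·) ((Finset.sum_congr rfl fun x _ => hF x).trans hsum)).trans ?_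
  rw [Finset.sum_boole, ← Fintype.card_subtype, ← Nat.card_eq_fintype_card,
    ← Nat.card_eq_fintype_card, ← card_conjugatesOf_mul_card_centralizer (zau k l 0 r b),
    card_conjugatesOf_zau hl hk r hb]
  push_cast
  rw [mul_one]

/-! ### The `m`-th power map on `⟨a, u⟩` and the indicators for `4 ∣ m` -/

theorem mem_ker_vParity_iff [NeZero k] (x : ZD k l) :
    x ∈ (vParity k l).ker ↔ ∃ p q : ℤ, x = zau k l 0 p q := by
  constructor
  · intro hx
    obtain ⟨p, q, rfl | rfl⟩ := eq_zau_or_eq_zau_mul_v x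
    · exact ⟨p, q, rfl⟩
    · exact absurd hx (zau_mul_v_notMem_ker_vParity 0 p q)
  · rintro ⟨p, q, rfl⟩
    exact zau_mem_ker_vParity 0 p q

theorem mul_pow_of_mem_ker_vParity [NeZero k] (hl : 2 ≤ l) {m : ℕ} (hm : 4 ∣ m) {x y : ZD k l}
    (hx : x ∈ (vParity k l).ker) (hy : y ∈ (vParity k l).ker) :
    (x * y) ^ m = x ^ m * y ^ m := by
  obtain ⟨p, q, rfl⟩ := (mem_ker_vParity_iff x).mp hx
  obtain ⟨p', q', rfl⟩ := (mem_ker_vParity_iff y).mp hy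
  rw [zau_mul_zau hl, zau_pow hl hm, zau_pow hl hm, zau_pow hl hm, zau_mul_zau hl, mul_add, mul_add]
  have h2 : (2 : ℤ) ∣ m := by omega
  exact zau_congr hl _ _ (by
    rw [zero_sub, dvd_neg, add_zero, zero_add, mul_assoc]
    exact h2.mul_right _)

/-- Squares are central in `⟨a, u⟩`, because the commutator form takes values modulo 2. -/
theorem pow_mem_centralizer [NeZero k] (hl : 2 ≤ l) (hk : 2 ∣ k) {m : ℕ} (hm : 2 ∣ m) (r b : ℤ)
    {x : ZD k l} (hx : x ∈ (vParity k l).ker) :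
    x ^ m ∈ Subgroup.centralizer {zau k l 0 r b} := by
  obtain ⟨p, q, rfl⟩ := (mem_ker_vParity_iff x).mp hx
  obtain ⟨n, rfl⟩ := hm
  rw [pow_mul]
  refine Subgroup.pow_mem _ ?_ n
  rw [sq, zau_mul_zau hl, zau_mem_centralizer_iff hl hk]
  exact ⟨q * r - b * p, by ring⟩

/-- The `m`-th power map from `⟨a, u⟩` to a centralizer, a homomorphism if `4 ∣ m`. -/
def powHom [NeZero k] (hl : 2 ≤ l) (hk : 2 ∣ k) {m : ℕ} (hm : 4 ∣ m) (r b : ℤ) :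
    (vParity k l).ker →* Subgroup.centralizer ({zau k l 0 r b} : Set (ZD k l)) :=
  MonoidHom.mk' (fun x => ⟨(x : ZD k l) ^ m,
      pow_mem_centralizer hl hk ((by norm_num : 2 ∣ 4).trans hm) r b x.2⟩)
    fun x y => Subtype.ext (mul_pow_of_mem_ker_vParity hl hm x.2 y.2)

theorem closure_le_centralizer [NeZero k] (hl : 2 ≤ l) (hk : 2 ∣ k) (r b : ℤ) :
    Subgroup.closure {a k l ^ 2, u k l ^ 2} ≤ Subgroup.centralizer {zau k l 0 r b} := by
  rw [Subgroup.closure_le]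
  have ha : a k l = zau k l 0 1 0 := by simp [zau]
  have hu : u k l = zau k l 0 0 1 := by simp [zau]
  rintro _ (rfl | rfl)
  · rw [ha]
    exact pow_mem_centralizer hl hk dvd_rfl r b (zau_mem_ker_vParity _ _ _)
  · rw [hu]
    exact pow_mem_centralizer hl hk dvd_rfl r b (zau_mem_ker_vParity _ _ _)

theorem sq_mem_closure [NeZero k] (hl : 2 ≤ l) {x : ZD k l} (hx : x ∈ (vParity k l).ker) :
    x ^ 2 ∈ Subgroup.closure {a k l ^ 2, u k l ^ 2} := by
  obtain ⟨p, q, rfl⟩ := (mem_ker_vParity_iff x).mp hx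
  have ha : a k l ^ 2 ∈ Subgroup.closure {a k l ^ 2, u k l ^ 2} :=
    Subgroup.subset_closure (by simp)
  have hu : u k l ^ 2 ∈ Subgroup.closure {a k l ^ 2, u k l ^ 2} :=
    Subgroup.subset_closure (by simp)
  -- The square of `a^p u^q` carries a factor `z^{p q}`, and `z = (a²)^{2^{l-2}}`.
  have hz : z k l ∈ Subgroup.closure {a k l ^ 2, u k l ^ 2} := by
    rw [z, show l - 1 = (l - 2) + 1 by omega, pow_succ' 2, pow_mul]
    exact Subgroup.pow_mem _ ha _
  rw [sq (zau k l 0 p q), zau_mul_zau hl, zau]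
  refine mul_mem (mul_mem (zpow_mem hz _) ?_) ?_
  · rw [← two_mul, zpow_mul]
    exact zpow_mem ha _
  · rw [← two_mul, zpow_mul]
    exact zpow_mem hu _

/-- Write `x^m = (x²)^{m/2}`: the squares of `⟨a, u⟩` lie in `⟨a², u²⟩` and include its generators.
-/
theorem comp_powHom_eq_one_iff [NeZero k] (hl : 2 ≤ l) (hk : 2 ∣ k) {m : ℕ} (hm : 4 ∣ m) (r b : ℤ)
    (η : Subgroup.centralizer ({zau k l 0 r b} : Set (ZD k l)) →* ℂˣ) :
    η.comp (powHom hl hk hm r b) = 1 ↔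
      ∀ c : Subgroup.centralizer ({zau k l 0 r b} : Set (ZD k l)),
        (c : ZD k l) ∈ Subgroup.closure {a k l ^ 2, u k l ^ 2} → (η ^ (m / 2)) c = 1 := by
  have hm2 : 2 * (m / 2) = m := by omega
  have hpow : ∀ x : (vParity k l).ker, ∀ h : (x : ZD k l) ^ 2 ∈
      Subgroup.centralizer ({zau k l 0 r b} : Set (ZD k l)),
      η (powHom hl hk hm r b x) = (η ^ (m / 2)) ⟨(x : ZD k l) ^ 2, h⟩ := by
    intro x h
    rw [MonoidHom.pow_apply, ← map_pow]
    congr 1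
    refine Subtype.ext ?_
    change (x : ZD k l) ^ m = ((x : ZD k l) ^ 2) ^ (m / 2)
    rw [← pow_mul, hm2]
  constructor
  · intro h c hc
    -- The kernel is pushed forward to the ambient group, where it can be tested on the two
    -- generators.
    have hle : Subgroup.closure {a k l ^ 2, u k l ^ 2} ≤
        (η ^ (m / 2)).ker.map (Subgroup.subtype _) := by
      rw [Subgroup.closure_le]
      have key : ∀ x ∈ (vParity k l).ker, x ^ 2 ∈ (η ^ (m / 2)).ker.map (Subgroup.subtype _) := by
        intro x hx
        refine ⟨⟨x ^ 2, pow_mem_centralizer hl hk dvd_rfl r b hx⟩, ?_, rfl⟩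
        rw [SetLike.mem_coe, MonoidHom.mem_ker, ← hpow ⟨x, hx⟩]
        exact DFunLike.congr_fun h (⟨x, hx⟩ : (vParity k l).ker)
      rintro _ (rfl | rfl)
      · exact key _ (by simp [MonoidHom.mem_ker, vParity])
      · exact key _ (by simp [MonoidHom.mem_ker, vParity])
    obtain ⟨c', hc', he⟩ := hle hc
    rw [← Subtype.ext he]
    exact hc'
  · intro h
    ext1 x
    rw [MonoidHom.comp_apply, hpow x (pow_mem_centralizer hl hk dvd_rfl r b x.2), MonoidHom.one_apply]
    exact h _ (sq_mem_closure hl x.2)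

open Classical in
theorem indicator_of_four_dvd [NeZero k] (hl : 2 ≤ l) (hk : 4 ∣ k) (r : ℤ) {b : ℤ}
    (hb : Odd b) (η : Subgroup.centralizer ({zau k l 0 r b} : Set (ZD k l)) →* ℂˣ) {m : ℕ}
    (hm : 4 ∣ m) :
    indicator (DrinfeldDouble (ZD k l)) (ClassModule (zau k l 0 r b) (linearRep η)) m =
      if (k : ℤ) ∣ m * b ∧ (2 : ℤ) ^ l ∣ m * r ∧
          (∀ c : Subgroup.centralizer ({zau k l 0 r b} : Set (ZD k l)),
            (c : ZD k l) ∈ Subgroup.closure {a k l ^ 2, u k l ^ 2} → (η ^ (m / 2)) c = 1)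
        then 4 else 2 := by
  have hk2 : 2 ∣ k := (by norm_num : 2 ∣ 4).trans hk
  apply indicator_eq_sum hl hk r hb
  have hs1 : zau k l 0 r b ^ m = 1 ↔ (k : ℤ) ∣ m * b ∧ (2 : ℤ) ^ l ∣ m * r := by
    rw [zau_pow hl hm, zau_zero, a_zpow_mul_u_zpow_eq_one_iff hl hk2, and_comm]
  -- The first two terms form the indicator function of the coset outside `⟨a, u⟩`, where each `x`
  -- contributes 1; the last term is the contribution of `⟨a, u⟩`.
  have hF : ∀ x : ZD k l, (if (x * zau k l 0 r b) ^ m = x ^ m then extendByZero η (x ^ m) else 0) =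
      1 - (if x ∈ (vParity k l).ker then 1 else 0) + (if x ∈ (vParity k l).ker then
        (if zau k l 0 r b ^ m = 1 then extendByZero η (x ^ m) else 0) else 0) := by
    intro x
    obtain ⟨p, q, rfl | rfl⟩ := eq_zau_or_eq_zau_mul_v x
    · rw [if_pos (zau_mem_ker_vParity _ _ _), if_pos (zau_mem_ker_vParity _ _ _), sub_self, zero_add,
        mul_pow_of_mem_ker_vParity hl hm (zau_mem_ker_vParity _ _ _) (zau_mem_ker_vParity _ _ _)]
      simp only [mul_eq_left]
    · rw [if_neg (zau_mul_v_notMem_ker_vParity _ _ _), if_neg (zau_mul_v_notMem_ker_vParity _ _ _),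
        sub_zero, add_zero, zau_mul_v_mul_zau hl]
      -- Squares outside `⟨a, u⟩` are powers of `z`, so fourth powers are trivial; this applies to
      -- both `x` and `x s`.
      have hone : ∀ c p q : ℤ, (zau k l c p q * v k l) ^ m = 1 := by
        intro c p q
        obtain ⟨n, rfl⟩ := hm
        rw [show 4 * n = 2 * (2 * n) by ring, pow_mul, zau_mul_v_sq hl, ← zpow_natCast, ← zpow_mul]
        refine z_zpow_even hl (Dvd.dvd.mul_left ?_ _)
        push_cast
        exact ⟨_, rfl⟩
      rw [hone, hone, if_pos rfl, extendByZero_one]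
  have hK : ∀ f : ZD k l → ℂ, (∑ x : ZD k l, if x ∈ (vParity k l).ker then f x else 0) =
      ∑ x : (vParity k l).ker, f x := by
    intro f
    rw [← Finset.sum_filter]
    exact Finset.sum_subtype _ (by simp) _
  have hcard : (Fintype.card (vParity k l).ker : ℂ) * 2 = Fintype.card (ZD k l) := by
    have h := card_ker_vParity (k := k) (l := l)
    rw [Nat.card_eq_fintype_card, Nat.card_eq_fintype_card] at h
    exact_mod_cast h
  rw [Finset.sum_congr rfl fun x _ => hF x, Finset.sum_add_distrib, Finset.sum_sub_distrib, hK, hK,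
    Finset.sum_const, Finset.sum_const, Finset.card_univ, Finset.card_univ, nsmul_one, nsmul_one,
    ← hcard]
  by_cases hs : zau k l 0 r b ^ m = 1
  · have hψ : ∀ x : (vParity k l).ker, (if zau k l 0 r b ^ m = 1 then
        extendByZero η ((x : ZD k l) ^ m) else 0) =
        ((Units.coeHom ℂ).comp (η.comp (powHom hl hk2 hm r b))) x := by
      intro x
      rw [if_pos hs]
      exact extendByZero_of_mem η (powHom hl hk2 hm r b x).2
    have hψ1 : (Units.coeHom ℂ).comp (η.comp (powHom hl hk2 hm r b)) = 1 ↔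
        η.comp (powHom hl hk2 hm r b) = 1 := by
      constructor
      · intro h
        ext x
        exact DFunLike.congr_fun h x
      · intro h
        rw [h, MonoidHom.comp_one]
    -- Orthogonality: a homomorphism to `ℂ` sums over the finite group to its order if trivial, and
    -- to 0 otherwise.
    rw [Finset.sum_congr rfl fun x _ => hψ x, sum_hom_units]
    simp only [hψ1, comp_powHom_eq_one_iff, ← and_assoc, ← hs1, hs, true_and]
    split_ifs <;> push_cast <;> ring
  · simp only [hs, if_false, Finset.sum_const_zero]
    rw [if_neg (fun h => hs (hs1.mpr ⟨h.1, h.2.1⟩))]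
    ring

end ZD

/-! ### The theorem -/

theorem mainTheorem12 (k l : ℕ) [NeZero k] (hl : 3 ≤ l) (hk : 4 ∣ k) (r i : ℤ)
    (s : ZD k l) (hs : s = ZD.a k l ^ r * ZD.u k l ^ (2 * i - 1))
    (η : Subgroup.centralizer ({s} : Set (ZD k l)) →* ℂˣ)
    (H : Subgroup (ZD k l)) (hH : H = Subgroup.closure {ZD.a k l ^ 2, ZD.u k l ^ 2}) :
    H ≤ Subgroup.centralizer {s} ∧
    IsSimpleModule (DrinfeldDouble (ZD k l)) (ClassModule s (linearRep η)) ∧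
    Module.finrank ℂ (ClassModule s (linearRep η)) = 4 ∧
    (∀ m : ℕ, 1 < m →
      (((k : ℤ) ∣ m * (2 * i - 1) ∧ (2 : ℤ) ^ l ∣ m * r ∧
          (∀ c : Subgroup.centralizer ({s} : Set (ZD k l)), (c : ZD k l) ∈ H →
            (η ^ (m / 2)) c = 1)) →
        indicator (DrinfeldDouble (ZD k l)) (ClassModule s (linearRep η)) m = 4) ∧
      (4 ∣ m → ¬ ((k : ℤ) ∣ m * (2 * i - 1) ∧ (2 : ℤ) ^ l ∣ m * r ∧
          (∀ c : Subgroup.centralizer ({s} : Set (ZD k l)), (c : ZD k l) ∈ H →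
            (η ^ (m / 2)) c = 1)) →
        indicator (DrinfeldDouble (ZD k l)) (ClassModule s (linearRep η)) m = 2) ∧
      (2 ∣ m → ¬ 4 ∣ m →
        indicator (DrinfeldDouble (ZD k l)) (ClassModule s (linearRep η)) m = 1) ∧
      (¬ 2 ∣ m →
        indicator (DrinfeldDouble (ZD k l)) (ClassModule s (linearRep η)) m = 0)) ∧
    indicator (DrinfeldDouble (ZD k l)) (ClassModule s (linearRep η)) 2 = 1 := by 
  have hl2 : 2 ≤ l := by omega
  have hk2 : 2 ∣ k := (by norm_num : 2 ∣ 4).trans hk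
  have hb : Odd (2 * i - 1) := ⟨i - 1, by ring⟩
  rw [← ZD.zau_zero] at hs
  subst hs hH
  have h4 := fun m hm => ZD.indicator_of_four_dvd (m := m) hl2 hk r hb η hm
  refine ⟨ZD.closure_le_centralizer hl2 hk2 r _, isSimpleModule_classModule η,
    (finrank_classModule η).trans (ZD.card_conjugatesOf_zau hl2 hk r hb), fun m _ =>
    ⟨fun h => ?_, fun hm h => ?_, ZD.indicator_of_two_dvd_of_not_four_dvd hl2 hk r hb η,
      ZD.indicator_of_odd hl2 hk r hb η⟩,
    ZD.indicator_of_two_dvd_of_not_four_dvd hl2 hk r hb η dvd_rfl (by norm_num)⟩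
  · have hm : (4 : ℤ) ∣ m * (2 * i - 1) := (by exact_mod_cast hk : (4 : ℤ) ∣ k).trans h.1
    have hm' : (4 : ℤ) ∣ m := by
      refine IsCoprime.dvd_of_dvd_mul_right ?_ hm
      -- Bézout coefficients from `(2i - 1)² = 4(i² - i) + 1`.
      exact ⟨-(i * i - i), 2 * i - 1, by ring⟩
    rw [h4 m (by exact_mod_cast hm'), if_pos h]
  · rw [h4 m hm, if_neg h]
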